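/- Let $L,\tilde a>0$ be such that $L/\tilde a$ is a positive integer, and fix $r,s\in\{+,-\}$. Write vectors of $\mathbb R^2$ as $\mathbf k=(k_+,k_-)$ and let $\mathbf e_\pm$ be the coordinate unit vectors. For $t=\pm$ put $$\Lambda_t^*=\{\mathbf k: k_\pm\in\tfrac{2\pi}{L}(\mathbb Z+\tfrac12),\ -\tfrac{\pi}{\tilde a}\le k_{-t}<\tfrac{\pi}{\tilde a}\},\qquad \tilde\Lambda_t^*=\{\mathbf p: p_\pm\in\tfrac{2\pi}{L}\mathbb Z,\ -\tfrac{\pi}{\tilde a}\le p_{-t}<\tfrac{\pi}{\tilde a}\}.$$ Let $\mathcal F$ be the fermion Fock space of the operators $\hat\psi_{r',s',\alpha}(\mathbf k)$ ($r',s',\alpha=\pm$, $\mathbf k\in\Lambda_{s'}^*$), which satisfy $\{\hat\psi_{r',s',\alpha}(\mathbf k),\hat\psi^\dagger_{r'',s'',\alpha'}(\mathbf k')\}=(L/2\pi)^2\delta_{r',r''}\delta_{s',s''}\delta_{\alpha,\alpha'}\delta_{\mathbf k,\mathbf k'}$ and $\{\hat\psi,\hat\psi\}=0$, over the normalized Dirac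 vacuum $\Omega$, for which $\hat\psi_{r',s',\alpha}(\mathbf k)\Omega=0$ if $r'k_{s'}>0$ and $\hat\psi^\dagger_{r',s',\alpha}(\mathbf k)\Omega=0$ if $r'k_{s'}<0$. Put $:\!\mathcal O\!:\,=\mathcal O-\langle\Omega,\mathcal O\Omega\rangle$ for fermion bilinears $\mathcal O$. For $\mathbf p$ with $p_\pm\in\tfrac{2\pi}{L}\mathbb Z$ let $$\hat J^\mu_{r,s}(\mathbf p)=\sum_{\alpha,\beta=\pm}\ \sum_{\mathbf k_1,\mathbf k_2\in\Lambda_s^*}\ \sum_{n\in\mathbb Z}\Bigl(\tfrac{2\pi}{L}\Bigr)^2:\!\hat\psi^\dagger_{r,s,\alpha}(\mathbf k_1)\sigma^\mu_{\alpha,\beta}\hat\psi_{r,s,\beta}(\mathbf k_2)\!:\ \delta_{\mathbf k_1+\mathbf p,\ \mathbf k_2+2\pi n\mathbf e_{-s}/\tilde a}\qquad(\mu=0,1,2,3),$$ where $\sigma^0$ is the unit matrix and $\sigma^1,\sigma^2,\sigma^3$ are the Pauli matrices, and set $\hat J_{r,s}=\hat J^0_{r,s}$, $\hat J_{r,s,\pm}=\frac12(\hat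 J^0_{r,s}\pm\hat J^3_{r,s})$, $\hat S^i_{r,s}=\frac12\hat J^i_{r,s}$ for $i=1,2,3$. Write $A^\dagger A$ for $A(-\mathbf p)A(\mathbf p)$ and $\hat{\mathbf S}^\dagger\cdot\hat{\mathbf S}=\sum_{i=1}^3(\hat S^i)^\dagger\hat S^i$. The boson normal ordering $\stackrel{\times}{\times}A(\mathbf p)A(\mathbf p')\stackrel{\times}{\times}$ of operators of flavor $(r,s)$ is $A(\mathbf p)A(\mathbf p')$ if $rp_s<0$ and $A(\mathbf p')A(\mathbf p)$ if $rp_s\ge0$. Consider the three expressions $$H_1=\sum_{\alpha=\pm}\sum_{\mathbf k\in\Lambda_s^*}\Bigl(\tfrac{2\pi}{L}\Bigr)^2rk_s:\!\hat\psi^\dagger_{r,s,\alpha}(\mathbf k)\hat\psi_{r,s,\alpha}(\mathbf k)\!:,\qquad H_2=\tilde a\pi\sum_{\alpha=\pm}\sum_{\mathbf p\in\tilde\Lambda_s^*}\frac1{L^2}\stackrel{\times}{\times}\hat J^\dagger_{r,s,\alpha}\hat J_{r,s,\alpha}\stackrel{\times}{\times},$$ $$H_3=\tilde a\pi\sum_{\mathbf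 p\in\tilde\Lambda_s^*}\frac1{L^2}\stackrel{\times}{\times}\Bigl(\tfrac12\hat J^\dagger_{r,s}\hat J_{r,s}+\tfrac23\hat{\mathbf S}^\dagger_{r,s}\cdot\hat{\mathbf S}_{r,s}\Bigr)\stackrel{\times}{\times},$$ each as an operator on its natural domain in $\mathcal F$ (all vectors on which all products are defined and all series converge unconditionally in norm). Then all finite linear combinations of the occupation number basis vectors of $\mathcal F$ (particles and holes relative to $\Omega$) lie in the three domains, and on them $H_1=H_2$ (Kronig identity) and $H_2=H_3$ (two-dimensional Sugawara construction). All three expressions define self-adjoint operators, and these are the same operator: $H_1$ is self-adjoint, the closures $\overline{H_2}$ and $\overline{H_3}$ are self-adjoint, and $H_1=\overline{H_2}=\overline{H_3}$. -/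

import Mathlib

open scoped InnerProductSpace

/-! ### Unbounded operators on their natural domains -/

namespace UnboundedOp

variable {F : Type*} [NormedAddCommGroup F] [InnerProductSpace ℂ F]

/-- An everywhere defined bounded operator, seen as an unbounded operator. -/
def ofBounded (A : F →L[ℂ] F) : F →ₗ.[ℂ] F := (A : F →ₗ[ℂ] F).toPMap ⊤

/-- The operator product `S T`, with domain all `η` such that `η ∈ dom T` and `T η ∈ dom S`. -/
def mul (S T : F →ₗ.[ℂ] F) : F →ₗ.[ℂ] F where
  domain :=
    { carrier := {η | ∃ h : η ∈ T.domain, T ⟨η, h⟩ ∈ S.domain}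
      zero_mem' := ⟨T.domain.zero_mem, by
        have h0 : T ⟨0, T.domain.zero_mem⟩ = 0 := T.map_zero
        rw [h0]; exact S.domain.zero_mem⟩
      add_mem' := by
        rintro x y ⟨hx, hx'⟩ ⟨hy, hy'⟩
        refine ⟨T.domain.add_mem hx hy, ?_⟩
        have h0 : T ⟨x + y, T.domain.add_mem hx hy⟩ = T ⟨x, hx⟩ + T ⟨y, hy⟩ :=
          T.map_add ⟨x, hx⟩ ⟨y, hy⟩
        rw [h0]; exact S.domain.add_mem hx' hy'
      smul_mem' := by
        rintro c x ⟨hx, hx'⟩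
        refine ⟨T.domain.smul_mem c hx, ?_⟩
        have h0 : T ⟨c • x, T.domain.smul_mem c hx⟩ = c • T ⟨x, hx⟩ :=
          T.map_smul c ⟨x, hx⟩
        rw [h0]; exact S.domain.smul_mem c hx' }
  toFun :=
    { toFun := fun η => S ⟨T ⟨η.1, η.2.choose⟩, η.2.choose_spec⟩
      map_add' := by
        rintro ⟨x, hx, hx'⟩ ⟨y, hy, hy'⟩
        rw [← S.map_add]
        congr 1
        exact Subtype.ext (T.map_add ⟨x, hx⟩ ⟨y, hy⟩)
      map_smul' := by
        rintro c ⟨x, hx, hx'⟩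
        rw [RingHom.id_apply, ← S.map_smul]
        congr 1
        exact Subtype.ext (T.map_smul c ⟨x, hx⟩) }

/-- The sum `∑ᵢ Tᵢ` of a (possibly infinite) family of operators. Its domain consists of all `η`
in the domain of every `Tᵢ` for which the family `Tᵢ η` is (unconditionally) summable in norm. -/
noncomputable def sum {ι : Type*} (T : ι → (F →ₗ.[ℂ] F)) : F →ₗ.[ℂ] F where
  domain :=
    { carrier := {η | ∃ h : ∀ i, η ∈ (T i).domain, Summable fun i => T i ⟨η, h i⟩}
      zero_mem' := ⟨fun i => (T i).domain.zero_mem, by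
        have h0 : (fun i => T i ⟨0, (T i).domain.zero_mem⟩) = fun _ => 0 :=
          funext fun i => (T i).map_zero
        rw [h0]; exact summable_zero⟩
      add_mem' := by
        rintro x y ⟨hx, hx'⟩ ⟨hy, hy'⟩
        refine ⟨fun i => (T i).domain.add_mem (hx i) (hy i), ?_⟩
        have h0 : (fun i => T i ⟨x + y, (T i).domain.add_mem (hx i) (hy i)⟩)
            = fun i => T i ⟨x, hx i⟩ + T i ⟨y, hy i⟩ :=
          funext fun i => (T i).map_add ⟨x, hx i⟩ ⟨y, hy i⟩
        rw [h0]; exact hx'.add hy'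
      smul_mem' := by
        rintro c x ⟨hx, hx'⟩
        refine ⟨fun i => (T i).domain.smul_mem c (hx i), ?_⟩
        have h0 : (fun i => T i ⟨c • x, (T i).domain.smul_mem c (hx i)⟩)
            = fun i => c • T i ⟨x, hx i⟩ :=
          funext fun i => (T i).map_smul c ⟨x, hx i⟩
        rw [h0]; exact hx'.const_smul c }
  toFun :=
    { toFun := fun η => ∑' i, T i ⟨η.1, η.2.choose i⟩
      map_add' := by
        rintro ⟨x, hx, hx'⟩ ⟨y, hy, hy'⟩
        rw [← hx'.tsum_add hy']
        exact tsum_congr fun i => (T i).map_add ⟨x, hx i⟩ ⟨y, hy i⟩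
      map_smul' := by
        rintro c ⟨x, hx, hx'⟩
        rw [RingHom.id_apply, ← hx'.tsum_const_smul c]
        exact tsum_congr fun i => (T i).map_smul c ⟨x, hx i⟩ }

end UnboundedOp

/-! ### Fermion Fock space over a set of modes, in the occupation number representation -/

/-- The Hilbert space `ℓ²` over all finite sets of occupied modes. -/
abbrev FermionFock (ι : Type*) : Type _ := lp (fun _ : Finset ι => ℂ) 2

namespace FermionFock

variable {ι : Type*}

/-- The number basis vector in which exactly the modes in `S` are occupied. -/
noncomputable def basisVec (S : Finset ι) : FermionFock ι :=
  open Classical in lp.single 2 S (1 : ℂ)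

/-- The vacuum: no mode is occupied. -/
noncomputable def vacuum : FermionFock ι := basisVec ∅

/-- The finite linear combinations of number basis vectors. -/
noncomputable def finiteVectors (ι : Type*) : Submodule ℂ (FermionFock ι) :=
  Submodule.span ℂ (Set.range basisVec)

variable [LinearOrder ι]

/-- `(-1)` to the number of modes of `S` preceding `q` (Jordan–Wigner sign). -/
def jwSign (q : ι) (S : Finset ι) : ℂ := (-1) ^ (S.filter (· < q)).card

/-- The coefficients of `a(q) f`, where `a(q)` removes the mode `q`. -/
def annCoeff (q : ι) (f : Finset ι → ℂ) (S : Finset ι) : ℂ :=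
  if q ∈ S then 0 else jwSign q S * f (insert q S)

theorem norm_annCoeff_sq_le (q : ι) (f : FermionFock ι) (s : Finset (Finset ι)) :
    ∑ S ∈ s, ‖annCoeff q f S‖ ^ 2 ≤ ‖f‖ ^ 2 := by
  have h1 : ∑ S ∈ s, ‖annCoeff q f S‖ ^ 2
      = ∑ S ∈ s.filter (fun S => q ∉ S), ‖f (insert q S)‖ ^ 2 := by
    rw [Finset.sum_filter]
    refine Finset.sum_congr rfl fun S _ => ?_
    by_cases h : q ∈ S <;> simp [annCoeff, jwSign, h]
  have h2 : ∑ S ∈ s.filter (fun S => q ∉ S), ‖f (insert q S)‖ ^ 2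
      = ∑ S ∈ (s.filter (fun S => q ∉ S)).image (insert q), ‖f S‖ ^ 2 := by
    rw [Finset.sum_image]
    intro S hS T hT h
    simp only [Finset.coe_filter, Set.mem_ofPred_eq] at hS hT
    rw [← Finset.erase_insert hS.2, ← Finset.erase_insert hT.2]
    exact congrArg (fun U => Finset.erase U q) h
  rw [h1, h2]
  have := lp.sum_rpow_le_norm_rpow (p := 2) (by norm_num) f
    ((s.filter (fun S => q ∉ S)).image (insert q))
  simpa using this

/-- The bounded annihilation operator `a(q)` of the mode `q`. -/
noncomputable def ann (q : ι) : FermionFock ι →L[ℂ] FermionFock ι :=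
  LinearMap.mkContinuous
    { toFun := fun f => ⟨annCoeff q f, memℓp_gen' (C := ‖f‖ ^ 2) fun s => by
        simpa using norm_annCoeff_sq_le q f s⟩
      map_add' := fun f g => by
        ext S
        change annCoeff q (f + g) S = annCoeff q f S + annCoeff q g S
        by_cases h : q ∈ S <;> simp [annCoeff, h, mul_add]
      map_smul' := fun c f => by
        ext S
        change annCoeff q (c • f) S = c * annCoeff q f S
        by_cases h : q ∈ S <;> simp [annCoeff, h, mul_left_comm] } 1
    fun f => by
      rw [one_mul]
      refine lp.norm_le_of_forall_sum_le (by norm_num) (norm_nonneg f) fun s => ?_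
      simpa using norm_annCoeff_sq_le q f s

end FermionFock

/-! ### Nodal fermions -/

namespace Nodal

/-- The vectors of `ℝ²` are written in the coordinates `(k₊, k₋)`, indexed by the signs `±1`. -/
abbrev Momentum : Type := ℤˣ → ℝ

/-- The sign `±1` as a real number. -/
def sgn (t : ℤˣ) : ℝ := ((t : ℤ) : ℝ)

/-- Fermion momenta: `k± ∈ (2π/L)(ℤ + 1/2)`, with `k₋ₛ` in the interval `[-π/ã, π/ã)`. -/
def fermiMomenta (L a : ℝ) (s : ℤˣ) : Set Momentum :=
  {k | (∀ t, ∃ m : ℤ, k t = 2 * Real.pi / L * (m + 1 / 2)) ∧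
    -(Real.pi / a) ≤ k (-s) ∧ k (-s) < Real.pi / a}

/-- Boson momenta: `p± ∈ (2π/L)ℤ`, with `p₋ₛ` in the interval `[-π/ã, π/ã)`. -/
def bosonMomenta (L a : ℝ) (s : ℤˣ) : Set Momentum :=
  {p | (∀ t, ∃ m : ℤ, p t = 2 * Real.pi / L * m) ∧
    -(Real.pi / a) ≤ p (-s) ∧ p (-s) < Real.pi / a}

/-- The one-particle modes: flavor `(r, s)`, spin `α` and momentum `k`. -/
structure Mode (L a : ℝ) where
  r : ℤˣ
  s : ℤˣ
  α : ℤˣ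
  k : fermiMomenta L a s

/-- An arbitrary linear order of the modes, needed only to fix the signs in the occupation number
representation. -/
noncomputable instance instLinearOrderMode (L a : ℝ) : LinearOrder (Mode L a) :=
  open Classical in linearOrderOfSTO WellOrderingRel

/-- The nodal fermion Fock space. Since the reference state is the Dirac sea, an occupied mode is
a particle if `r kₛ > 0` and a hole if `r kₛ < 0`. -/
abbrev Fock (L a : ℝ) : Type := FermionFock (Mode L a)

/-- The Dirac vacuum. -/
noncomputable def Ω (L a : ℝ) : Fock L a := FermionFock.vacuum

variable {L a : ℝ}

/-- The fermion operator `ψ̂_{r,s,α}(k)`, normalised by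
`{ψ̂(q), ψ̂†(q')} = (L/2π)² δ_{q,q'}`: it annihilates a particle if `r kₛ > 0` and creates a hole
if `r kₛ < 0`. -/
noncomputable def psi (r s α : ℤˣ) (k : fermiMomenta L a s) : Fock L a →L[ℂ] Fock L a :=
  ((L / (2 * Real.pi) : ℝ) : ℂ) •
    if 0 < sgn r * k.1 s then FermionFock.ann ⟨r, s, α, k⟩
    else ContinuousLinearMap.adjoint (FermionFock.ann ⟨r, s, α, k⟩)

/-- The Hilbert space adjoint `ψ̂†_{r,s,α}(k)`. -/
noncomputable def psiDag (r s α : ℤˣ) (k : fermiMomenta L a s) : Fock L a →L[ℂ] Fock L a :=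
  ContinuousLinearMap.adjoint (psi r s α k)

/-- Fermion normal ordering of a bilinear: `:O: = O - ⟨Ω, O Ω⟩`. -/
noncomputable def fermionOrder (O : Fock L a →L[ℂ] Fock L a) : Fock L a →L[ℂ] Fock L a :=
  O - ⟪Ω L a, O (Ω L a)⟫_ℂ • ContinuousLinearMap.id ℂ (Fock L a)

/-- The unit matrix `σ⁰` and the Pauli matrices `σ¹, σ², σ³`, with spin indices `±1`. -/
noncomputable def pauli : Fin 4 → Matrix ℤˣ ℤˣ ℂ
  | 0 => 1
  | 1 => Matrix.of fun α β => if α = β then 0 else 1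
  | 2 => Matrix.of fun α β => if α = β then 0 else -(Complex.I * (sgn α : ℂ))
  | 3 => Matrix.diagonal fun α => (sgn α : ℂ)

/-- The nodal bilinears
`Ĵ^μ_{r,s}(p) = ∑_{α,β} ∑_{k₁,k₂} ∑ₙ (2π/L)² :ψ̂†_{r,s,α}(k₁) σ^μ_{α,β} ψ̂_{r,s,β}(k₂):`
restricted to `k₁ + p = k₂ + (2πn/ã) e₋ₛ`. -/
noncomputable def J (L a : ℝ) (r s : ℤˣ) (μ : Fin 4) (p : Momentum) :
    Fock L a →ₗ.[ℂ] Fock L a :=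
  UnboundedOp.sum fun i : (ℤˣ × ℤˣ) × (fermiMomenta L a s × fermiMomenta L a s) × ℤ =>
    open Classical in
    UnboundedOp.ofBounded
      (if i.2.1.1.1 + p = i.2.1.2.1 + Pi.single (-s) (2 * Real.pi * i.2.2 / a) then
        (((2 * Real.pi / L) ^ 2 : ℝ) : ℂ) •
          fermionOrder (psiDag r s i.1.1 i.2.1.1 * (pauli μ i.1.1 i.1.2 • psi r s i.1.2 i.2.1.2))
      else 0)

/-- The spin-dependent densities `Ĵ_{r,s,±} = (Ĵ⁰_{r,s} ± Ĵ³_{r,s}) / 2`. -/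
noncomputable def spinDensity (L a : ℝ) (r s α : ℤˣ) (p : Momentum) : Fock L a →ₗ.[ℂ] Fock L a :=
  (1 / 2 : ℂ) • (J L a r s 0 p + (sgn α : ℂ) • J L a r s 3 p)

/-- The spin operators `Ŝⁱ_{r,s} = Ĵⁱ_{r,s} / 2`, where `i = 0, 1, 2` stands for the three space
directions. -/
noncomputable def spinOp (L a : ℝ) (r s : ℤˣ) (i : Fin 3) (p : Momentum) : Fock L a →ₗ.[ℂ] Fock L a :=
  (1 / 2 : ℂ) • J L a r s i.succ p

/-- Boson normal ordering of the product `A(p) B(p')` of two nodal densities of flavor `(r, s)`. -/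
noncomputable def bosonOrder (r s : ℤˣ) (A B : Momentum → (Fock L a →ₗ.[ℂ] Fock L a))
    (p p' : Momentum) : Fock L a →ₗ.[ℂ] Fock L a :=
  open Classical in
  if sgn r * p s < 0 then UnboundedOp.mul (A p) (B p') else UnboundedOp.mul (B p') (A p)

/-- The boson normal ordered product `A†A`, where `A†A` is short for `A(-p) A(p)`. -/
noncomputable def orderedSquare (r s : ℤˣ) (A : Momentum → (Fock L a →ₗ.[ℂ] Fock L a))
    (p : Momentum) : Fock L a →ₗ.[ℂ] Fock L a :=
  bosonOrder r s A A (-p) p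

/-- The normal ordered nodal kinetic energy
`∑_α ∑_k (2π/L)² r kₛ :ψ̂†_{r,s,α}(k) ψ̂_{r,s,α}(k):`. -/
noncomputable def kineticEnergy (L a : ℝ) (r s : ℤˣ) : Fock L a →ₗ.[ℂ] Fock L a :=
  UnboundedOp.sum fun i : ℤˣ × fermiMomenta L a s =>
    UnboundedOp.ofBounded
      ((((2 * Real.pi / L) ^ 2 * (sgn r * i.2.1 s) : ℝ) : ℂ) •
        fermionOrder (psiDag r s i.1 i.2 * psi r s i.1 i.2))

/-- `ã π ∑_α ∑_p L⁻² ××Ĵ†_{r,s,α} Ĵ_{r,s,α}××`. -/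
noncomputable def kronigForm (L a : ℝ) (r s : ℤˣ) : Fock L a →ₗ.[ℂ] Fock L a :=
  ((a * Real.pi : ℝ) : ℂ) •
    UnboundedOp.sum fun i : ℤˣ × bosonMomenta L a s =>
      ((1 / L ^ 2 : ℝ) : ℂ) • orderedSquare r s (spinDensity L a r s i.1) i.2.1

/-- `ã π ∑_p L⁻² ××(½ Ĵ†_{r,s} Ĵ_{r,s} + ⅔ Ŝ†_{r,s} · Ŝ_{r,s})××`. -/
noncomputable def sugawaraForm (L a : ℝ) (r s : ℤˣ) : Fock L a →ₗ.[ℂ] Fock L a :=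
  ((a * Real.pi : ℝ) : ℂ) •
    UnboundedOp.sum fun p : bosonMomenta L a s =>
      ((1 / L ^ 2 : ℝ) : ℂ) •
        ((1 / 2 : ℂ) • orderedSquare r s (J L a r s 0) p.1 +
          (2 / 3 : ℂ) • ∑ i : Fin 3, orderedSquare r s (spinOp L a r s i) p.1)

end Nodal

/-! In the number basis $H_1$ is multiplication by the sum of $|rk_s|$ over the occupied modes of
flavor $(r,s)$. As an unconditional sum of nonnegative multiplication operators it has the maximal
domain (`isMultiplication_sum`), so it is self-adjoint and the finite vectors are a core.

The identities on finite vectors are algebra. A momentum has an integer coordinate $l$ along $s$ and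
a transverse coordinate in $\mathbb Z/M$, $M=L/\tilde a$; the sum over $n$ makes transverse momentum
conserved only modulo $M$. A finite vector looks like the vacuum outside a window $[-N,N)$ of values
of $l$, and on it each density is a finite bilinear. A product of two bilinears is a bilinear plus a
quartic term. Boson ordering puts longitudinal momentum $-|q|$ on the left and $|q|$ on the right,
so the sum over $q$ weights a transfer $d$ by the number of integers of absolute value $d$, and the
weights of $d$ and $-d$ add up to 2. The symmetrised quartic coefficient thus involves only total
momentum conservation and the spin tensor $\sum_i w_iV_i\otimes V_i$. If this tensor is symmetric in
its column indices, anticommutation kills the quartic term (`IsCAR.quartic_eq_zero`). If also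
$\sum_i w_iV_i^2=1$, the bilinear left over has coefficient $M(2(l+N)+1)$, which the vacuum
subtractions turn into $2M(l+\frac12)$ (`Site.sum_nquad_hop`).

Kronig and Sugawara are two choices of spin matrices: the projections onto the two spins, and
$1,\frac12\sigma^i$ with
$\frac12\,1\otimes1+\frac16\sum_i\sigma^i\otimes\sigma^i=\frac13(1+\mathrm{swap})$.

Finally, $H_2$ and $H_3$ are symmetric when tested against finite vectors, which forces them to be
restrictions of $H_1$; they agree with $H_1$ on a core, so their closures equal $H_1$
(`IsMultiplication.closure_eq`). -/

namespace UnboundedOp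

/-! ### Calculus of unbounded operators through their graphs. -/

section Maps

variable {F : Type*} [NormedAddCommGroup F] [InnerProductSpace ℂ F]

/-- `T` is defined at `η` and has the value `ξ` there. -/
def Maps (T : F →ₗ.[ℂ] F) (η ξ : F) : Prop := ∃ h : η ∈ T.domain, T ⟨η, h⟩ = ξ

theorem maps_apply (T : F →ₗ.[ℂ] F) {η : F} (h : η ∈ T.domain) : Maps T η (T ⟨η, h⟩) := ⟨h, rfl⟩

theorem Maps.unique {T : F →ₗ.[ℂ] F} {η ξ ξ' : F} (h : Maps T η ξ) (h' : Maps T η ξ') :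
    ξ = ξ' := by
  obtain ⟨_, rfl⟩ := h
  obtain ⟨_, rfl⟩ := h'
  rfl

theorem maps_smul_vec {T : F →ₗ.[ℂ] F} {η ξ : F} (c : ℂ) (h : Maps T η ξ) :
    Maps T (c • η) (c • ξ) := by
  obtain ⟨h1, rfl⟩ := h
  exact ⟨T.domain.smul_mem c h1, T.map_smul c ⟨η, h1⟩⟩

theorem maps_zero_vec (T : F →ₗ.[ℂ] F) : Maps T 0 0 := ⟨T.domain.zero_mem, T.map_zero⟩

theorem maps_ofBounded {A : F →L[ℂ] F} {η ξ : F} : Maps (ofBounded A) η ξ ↔ A η = ξ :=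
  ⟨fun h => h.2, fun h => ⟨Submodule.mem_top, h⟩⟩

theorem maps_mul {S T : F →ₗ.[ℂ] F} {η ζ : F} :
    Maps (mul S T) η ζ ↔ ∃ ξ, Maps T η ξ ∧ Maps S ξ ζ := by
  constructor
  · rintro ⟨⟨h, h'⟩, rfl⟩
    exact ⟨_, ⟨h, rfl⟩, ⟨h', rfl⟩⟩
  · rintro ⟨_, ⟨h, rfl⟩, ⟨h', rfl⟩⟩
    exact ⟨⟨h, h'⟩, rfl⟩

theorem maps_sum {ι : Type*} {T : ι → (F →ₗ.[ℂ] F)} {η ζ : F} :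
    Maps (sum T) η ζ ↔ ∃ f : ι → F, (∀ i, Maps (T i) η (f i)) ∧ HasSum f ζ := by
  constructor
  · rintro ⟨⟨h, h'⟩, rfl⟩
    exact ⟨fun i => T i ⟨η, h i⟩, fun i => ⟨h i, rfl⟩, h'.hasSum⟩
  · rintro ⟨f, hf, hs⟩
    have h : ∀ i, η ∈ (T i).domain := fun i => (hf i).1
    have hfe : f = fun i => T i ⟨η, h i⟩ := funext fun i => (hf i).2.symm
    subst hfe
    exact ⟨⟨h, hs.summable⟩, hs.tsum_eq⟩

theorem maps_add {S T : F →ₗ.[ℂ] F} {η ζ : F} :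
    Maps (S + T) η ζ ↔ ∃ ξ ξ', Maps S η ξ ∧ Maps T η ξ' ∧ ξ + ξ' = ζ := by
  constructor
  · rintro ⟨⟨h, h'⟩, rfl⟩
    exact ⟨_, _, ⟨h, rfl⟩, ⟨h', rfl⟩, rfl⟩
  · rintro ⟨_, _, ⟨h, rfl⟩, ⟨h', rfl⟩, rfl⟩
    exact ⟨⟨h, h'⟩, rfl⟩

theorem maps_smul {T : F →ₗ.[ℂ] F} {c : ℂ} {η ζ : F} :
    Maps (c • T) η ζ ↔ ∃ ξ, Maps T η ξ ∧ c • ξ = ζ := by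
  constructor
  · rintro ⟨h, rfl⟩
    exact ⟨_, ⟨h, rfl⟩, rfl⟩
  · rintro ⟨_, ⟨h, rfl⟩, rfl⟩
    exact ⟨h, rfl⟩

theorem Maps.smul {T : F →ₗ.[ℂ] F} {η ξ : F} (c : ℂ) (h : Maps T η ξ) :
    Maps (c • T) η (c • ξ) := maps_smul.2 ⟨ξ, h, rfl⟩

theorem Maps.add {S T : F →ₗ.[ℂ] F} {η ξ ξ' : F} (h : Maps S η ξ) (h' : Maps T η ξ') :
    Maps (S + T) η (ξ + ξ') := maps_add.2 ⟨ξ, ξ', h, h', rfl⟩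

theorem le_of_maps {S T : F →ₗ.[ℂ] F} (h : ∀ η ξ, Maps S η ξ → Maps T η ξ) : S ≤ T := by
  refine ⟨fun η hη => (h η _ (maps_apply S hη)).1, ?_⟩
  rintro ⟨x, hx⟩ ⟨y, hy⟩ hxy
  obtain rfl : x = y := hxy
  exact ((h x _ (maps_apply S hx)).2).symm

theorem mem_graph_iff_maps {T : F →ₗ.[ℂ] F} {η ξ : F} : (η, ξ) ∈ T.graph ↔ Maps T η ξ := by
  rw [LinearPMap.mem_graph_iff]
  constructor
  · rintro ⟨y, rfl, rfl⟩
    exact ⟨y.2, rfl⟩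
  · rintro ⟨h, rfl⟩
    exact ⟨⟨η, h⟩, rfl, rfl⟩

end Maps

end UnboundedOp

/-! ### Multiplication operators in the number basis. -/

namespace FermionFock

variable {ι : Type*}

theorem basisVec_apply (S T : Finset ι) [Decidable (T = S)] :
    (basisVec S : FermionFock ι) T = if T = S then 1 else 0 := by
  classical
  unfold basisVec
  rw [lp.single_apply, Pi.single_apply]
  congr

theorem basisVec_mem (S : Finset ι) : basisVec S ∈ finiteVectors ι :=
  Submodule.subset_span ⟨S, rfl⟩

theorem inner_basisVec_left (S : Finset ι) (f : FermionFock ι) : ⟪basisVec S, f⟫_ℂ = f S := by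
  classical
  unfold basisVec
  rw [lp.inner_single_left]
  simp

theorem inner_basisVec_right (S : Finset ι) (f : FermionFock ι) :
    ⟪f, basisVec S⟫_ℂ = starRingEnd ℂ (f S) := by
  rw [← inner_conj_symm, inner_basisVec_left]

theorem hasSum_basisVec (f : FermionFock ι) : HasSum (fun S => f S • basisVec S) f := by
  classical
  have h := lp.hasSum_single (p := 2) (by norm_num) f
  convert h using 2 with S
  ext T
  rw [lp.coeFn_smul, Pi.smul_apply, basisVec_apply, lp.single_apply, Pi.single_apply]
  by_cases hT : T = S
  · subst hT; simp
  · simp [hT]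

theorem dense_finiteVectors : Dense (finiteVectors ι : Set (FermionFock ι)) := by
  intro f
  refine mem_closure_of_tendsto (hasSum_basisVec f) (Filter.Eventually.of_forall fun s => ?_)
  exact Submodule.sum_mem _ fun S _ => Submodule.smul_mem _ _ (basisVec_mem S)

theorem norm_le_of_coeff_le {f g : FermionFock ι} (h : ∀ S, ‖f S‖ ≤ ‖g S‖) : ‖f‖ ≤ ‖g‖ := by
  refine lp.norm_le_of_forall_sum_le (by norm_num) (norm_nonneg g) fun s => ?_
  refine le_trans (Finset.sum_le_sum fun S _ => ?_)
    (lp.sum_rpow_le_norm_rpow (p := 2) (by norm_num) g s)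
  exact Real.rpow_le_rpow (norm_nonneg _) (h S) (by norm_num)

open UnboundedOp

/-- `T` is the operator of multiplication by `E` in the number basis, on its maximal domain. -/
def IsMultiplication (T : FermionFock ι →ₗ.[ℂ] FermionFock ι) (E : Finset ι → ℝ) : Prop :=
  ∀ η ξ, Maps T η ξ ↔ ∀ S, ξ S = (E S : ℂ) * η S

namespace IsMultiplication

variable {T : FermionFock ι →ₗ.[ℂ] FermionFock ι} {E : Finset ι → ℝ}

theorem maps_basisVec (hT : IsMultiplication T E) (S : Finset ι) :
    Maps T (basisVec S) ((E S : ℂ) • basisVec S) := by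
  classical
  refine (hT _ _).2 fun S' => ?_
  rw [lp.coeFn_smul, Pi.smul_apply, basisVec_apply]
  by_cases h : S' = S
  · subst h; simp
  · simp [h]

theorem finiteVectors_le (hT : IsMultiplication T E) : finiteVectors ι ≤ T.domain := by
  refine Submodule.span_le.2 ?_
  rintro _ ⟨S, rfl⟩
  exact (hT.maps_basisVec S).1

theorem inner_eq (hT : IsMultiplication T E) {η ξ φ ζ : FermionFock ι} (h : Maps T η ξ)
    (h' : Maps T φ ζ) : ⟪ξ, φ⟫_ℂ = ⟪η, ζ⟫_ℂ := by
  rw [lp.inner_eq_tsum, lp.inner_eq_tsum]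
  refine tsum_congr fun S => ?_
  rw [(hT _ _).1 h S, (hT _ _).1 h' S]
  simp only [RCLike.inner_apply, map_mul, Complex.conj_ofReal]
  ring

/-- Weak form of the action of a multiplication operator. -/
theorem maps_of_inner (hT : IsMultiplication T E) {η ξ : FermionFock ι}
    (h : ∀ S, ⟪ξ, basisVec S⟫_ℂ = ⟪η, (E S : ℂ) • basisVec S⟫_ℂ) : Maps T η ξ := by
  refine (hT _ _).2 fun S => ?_
  have := h S
  rw [inner_smul_right, inner_basisVec_right, inner_basisVec_right] at this
  simpa using congrArg (starRingEnd ℂ) this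

theorem isSelfAdjoint (hT : IsMultiplication T E) : IsSelfAdjoint T := by
  -- Without a dense domain `LinearPMap.adjoint` would carry a default value.
  have hd : Dense (T.domain : Set (FermionFock ι)) := dense_finiteVectors.mono hT.finiteVectors_le
  rw [LinearPMap.isSelfAdjoint_def]
  refine le_antisymm (le_of_maps ?_) (LinearPMap.IsFormalAdjoint.le_adjoint hd ?_)
  -- Testing against number vectors alone already fixes every coefficient of the adjoint's value.
  · rintro η _ ⟨h, rfl⟩
    refine hT.maps_of_inner fun S => ?_
    have h1 := LinearPMap.adjoint_isFormalAdjoint (T := T) hd ⟨η, h⟩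
      ⟨basisVec S, (hT.maps_basisVec S).1⟩
    rw [(hT.maps_basisVec S).2] at h1
    exact h1
  · intro x y
    exact hT.inner_eq ⟨x.2, rfl⟩ ⟨y.2, rfl⟩

/-- The finite vectors are a core: expand both entries of a point of the graph in the number basis;
every partial sum lies in the graph of `S`. -/
theorem mem_closure_graph (hT : IsMultiplication T E) {S : FermionFock ι →ₗ.[ℂ] FermionFock ι}
    (hS : ∀ U, Maps S (basisVec U) ((E U : ℂ) • basisVec U)) {η ξ : FermionFock ι}
    (h : Maps T η ξ) : (η, ξ) ∈ S.graph.topologicalClosure := by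
  have h1 : HasSum (fun U => (η U • basisVec U, ξ U • basisVec U)) (η, ξ) :=
    (hasSum_basisVec η).prodMk (hasSum_basisVec ξ)
  refine mem_closure_of_tendsto h1 (Filter.Eventually.of_forall fun s => ?_)
  refine Submodule.sum_mem _ fun U _ => ?_
  refine mem_graph_iff_maps.2 ?_
  rw [(hT _ _).1 h U, mul_comm, mul_smul]
  exact maps_smul_vec _ (hS U)

/-- An operator which agrees with the multiplication operator `T` on the number basis, and is
symmetric against the number basis, has closure `T`. -/
theorem closure_eq (hT : IsMultiplication T E) {S : FermionFock ι →ₗ.[ℂ] FermionFock ι}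
    (hS : ∀ U, Maps S (basisVec U) ((E U : ℂ) • basisVec U))
    (hsymm : ∀ η ξ U, Maps S η ξ → ⟪ξ, basisVec U⟫_ℂ = ⟪η, (E U : ℂ) • basisVec U⟫_ℂ) :
    S.closure = T := by
  have hle : S ≤ T := le_of_maps fun η ξ h => hT.maps_of_inner fun U => hsymm η ξ U h
  have hTc : T.IsClosed := IsSelfAdjoint.isClosed hT.isSelfAdjoint
  -- Closability must be known, because `LinearPMap.closure` returns a non-closable operator
  -- unchanged.
  have hSc : S.IsClosable := hTc.isClosable.leIsClosable hle
  have hg := hSc.graph_closure_eq_closure_graph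
  refine le_antisymm (LinearPMap.le_of_le_graph ?_) (LinearPMap.le_of_le_graph ?_)
  · rw [← hg]
    exact Submodule.topologicalClosure_minimal _ (LinearPMap.le_graph_of_le hle) hTc
  · rintro ⟨η, ξ⟩ h
    rw [← hg]
    exact hT.mem_closure_graph hS (mem_graph_iff_maps.1 h)

end IsMultiplication

/-- An unconditional sum of nonnegative bounded multiplication operators is the maximal
multiplication operator by the sum of the multipliers. -/
theorem isMultiplication_sum {κ : Type*} (A : κ → (FermionFock ι →L[ℂ] FermionFock ι))
    (e : κ → Finset ι → ℝ) (he : ∀ i S, 0 ≤ e i S) (E : Finset ι → ℝ)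
    (s : Finset ι → Finset κ) (hs : ∀ S, ∀ i ∉ s S, e i S = 0)
    (hE : ∀ S, E S = ∑ i ∈ s S, e i S)
    (hA : ∀ i η S, (A i η) S = (e i S : ℂ) * η S) :
    IsMultiplication (UnboundedOp.sum fun i => ofBounded (A i)) E := by
  classical
  have hev : ∀ (S : Finset ι), Continuous fun f : FermionFock ι => f S := fun S =>
    (innerSL ℂ (basisVec S)).continuous.congr fun f => inner_basisVec_left S f
  have hsum : ∀ S (t : Finset κ), s S ⊆ t → ∑ i ∈ t, e i S = E S := fun S t ht => by
    rw [hE S]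
    exact (Finset.sum_subset ht fun i _ hi => hs S i hi).symm
  have hco : ∀ (t : Finset κ) (η : FermionFock ι) S,
      (∑ i ∈ t, A i η) S = ((∑ i ∈ t, e i S : ℝ) : ℂ) * η S := fun t η S => by
    rw [lp.coeFn_sum, Finset.sum_apply, Complex.ofReal_sum, Finset.sum_mul]
    exact Finset.sum_congr rfl fun i _ => hA i η S
  intro η ξ
  rw [maps_sum]
  constructor
  -- Coordinates are continuous, and the coordinate at `S` of the partial sums is constant once the
  -- index set contains `s S`.
  · rintro ⟨f, hf, hsf⟩ S
    obtain rfl : (fun i => A i η) = f := funext fun i => maps_ofBounded.1 (hf i)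
    have h1 := ((hev S).tendsto ξ).comp hsf
    refine tendsto_nhds_unique h1 (tendsto_const_nhds.congr' ?_)
    filter_upwards [Filter.eventually_ge_atTop (s S)] with t ht
    rw [Function.comp_apply, hco, hsum S t ht]
  · intro h
    refine ⟨fun i => A i η, fun i => maps_ofBounded.2 rfl, ?_⟩
    refine Metric.tendsto_atTop.2 fun ε hε => ?_
    obtain ⟨u, hu⟩ := Metric.tendsto_atTop.1 (hasSum_basisVec ξ) ε hε
    -- Here `ξ` is almost carried by `u`. Past this index set the error vanishes on `u`; off `u`,
    -- nonnegativity of the `e i` bounds it by the coefficient of `ξ`.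
    refine ⟨u.biUnion s, fun t ht => lt_of_le_of_lt ?_ (hu u le_rfl)⟩
    rw [dist_eq_norm, dist_eq_norm]
    refine norm_le_of_coeff_le fun S => ?_
    have hc : (∑ U ∈ u, ξ U • (basisVec U : FermionFock ι)) S = if S ∈ u then ξ S else 0 := by
      rw [lp.coeFn_sum, Finset.sum_apply]
      simp [basisVec_apply]
    rw [lp.coeFn_sub, lp.coeFn_sub, Pi.sub_apply, Pi.sub_apply, hco, hc, h S]
    by_cases hS : S ∈ u
    · rw [hsum S t ((Finset.subset_biUnion_of_mem s hS).trans ht)]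
      simp
    · rw [if_neg hS, zero_sub, norm_neg, ← sub_mul, norm_mul, norm_mul, ← Complex.ofReal_sub]
      refine mul_le_mul_of_nonneg_right ?_ (norm_nonneg _)
      rw [Complex.norm_real, Complex.norm_real, Real.norm_eq_abs, Real.norm_eq_abs]
      have h1 : 0 ≤ ∑ i ∈ t, e i S := Finset.sum_nonneg fun i _ => he i S
      have h2 : ∑ i ∈ t, e i S ≤ E S := by
        rw [← hsum S (t ∪ s S) Finset.subset_union_right]
        exact Finset.sum_le_sum_of_subset_of_nonneg Finset.subset_union_left fun i _ _ => he i S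
      rw [abs_of_nonpos (by linarith), abs_of_nonneg (by linarith)]
      linarith

end FermionFock

/-! ### Anticommutation relations on Fock space. -/

namespace FermionFock

variable {ι : Type*} [LinearOrder ι]

theorem jwSign_mul_self (q : ι) (S : Finset ι) : jwSign q S * jwSign q S = 1 := by
  rw [jwSign, ← mul_pow]
  norm_num

theorem conj_jwSign (q : ι) (S : Finset ι) : starRingEnd ℂ (jwSign q S) = jwSign q S := by
  simp [jwSign]

theorem jwSign_erase_self (q : ι) (S : Finset ι) : jwSign q (S.erase q) = jwSign q S := by
  unfold jwSign
  congr 2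
  ext x
  simp only [Finset.mem_filter, Finset.mem_erase]
  exact ⟨fun h => ⟨h.1.2, h.2⟩, fun h => ⟨⟨h.2.ne, h.1⟩, h.2⟩⟩

theorem jwSign_insert {q q' : ι} {S : Finset ι} (h : q' ∉ S) :
    jwSign q (insert q' S) = (if q' < q then -1 else 1) * jwSign q S := by
  unfold jwSign
  rw [Finset.filter_insert]
  split_ifs with hq
  · rw [Finset.card_insert_of_notMem (by simp [h]), pow_succ']
  · rw [one_mul]

/-- Exactly one of two distinct modes precedes the other, so exactly one of the two insertions flips
a sign. -/
theorem jwSign_exchange {q q' : ι} {S : Finset ι} (hqq : q ≠ q') (h : q ∉ S) (h' : q' ∉ S) :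
    jwSign q S * jwSign q' (insert q S) + jwSign q' S * jwSign q (insert q' S) = 0 := by
  rw [jwSign_insert h, jwSign_insert h']
  rcases lt_or_gt_of_ne hqq with hlt | hlt
  · rw [if_pos hlt, if_neg hlt.not_gt]; ring
  · rw [if_pos hlt, if_neg hlt.not_gt]; ring

theorem jwSign_exchange' {q q' : ι} {S : Finset ι} (hqq : q ≠ q') (h : q ∉ S) (h' : q' ∉ S) :
    jwSign q (insert q' S) * jwSign q' (insert q S) + jwSign q' S * jwSign q S = 0 := by
  rw [jwSign_insert h, jwSign_insert h']
  rcases lt_or_gt_of_ne hqq with hlt | hlt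
  · rw [if_pos hlt, if_neg hlt.not_gt]; ring
  · rw [if_pos hlt, if_neg hlt.not_gt]; ring

theorem ann_apply (q : ι) (f : FermionFock ι) (S : Finset ι) :
    ann q f S = if q ∈ S then 0 else jwSign q S * f (insert q S) := rfl

theorem ann_basisVec (q : ι) (S : Finset ι) :
    ann q (basisVec S) = if q ∈ S then jwSign q S • basisVec (S.erase q) else 0 := by
  ext T
  rw [ann_apply, basisVec_apply]
  by_cases hS : q ∈ S
  · rw [if_pos hS, lp.coeFn_smul, Pi.smul_apply, basisVec_apply, smul_eq_mul]
    by_cases hT : q ∈ T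
    · rw [if_pos hT, if_neg, mul_zero]
      rintro rfl
      exact Finset.notMem_erase q S hT
    · rw [if_neg hT]
      by_cases h : insert q T = S
      · subst h
        rw [Finset.erase_insert hT, if_pos rfl, if_pos rfl, ← jwSign_erase_self q (insert q T),
          Finset.erase_insert hT]
      · rw [if_neg h, if_neg, mul_zero, mul_zero]
        rintro rfl
        exact h (Finset.insert_erase hS)
  · have h : insert q T ≠ S := by
      rintro rfl
      exact hS (Finset.mem_insert_self _ _)
    simp [hS, h]

theorem adjoint_ann_apply (q : ι) (f : FermionFock ι) (S : Finset ι) :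
    star (ann q) f S = if q ∈ S then jwSign q S * f (S.erase q) else 0 := by
  rw [← inner_basisVec_left, ContinuousLinearMap.star_eq_adjoint,
    ContinuousLinearMap.adjoint_inner_right, ann_basisVec]
  split_ifs
  · rw [inner_smul_left, conj_jwSign, inner_basisVec_left]
  · rw [inner_zero_left]

theorem adjoint_ann_basisVec (q : ι) (S : Finset ι) :
    star (ann q) (basisVec S) = if q ∈ S then 0 else jwSign q S • basisVec (insert q S) := by
  ext T
  rw [adjoint_ann_apply, basisVec_apply]
  by_cases hS : q ∈ S
  · have h : T.erase q ≠ S := by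
      rintro rfl
      exact Finset.notMem_erase _ _ hS
    simp [hS, h]
  · rw [if_neg hS, lp.coeFn_smul, Pi.smul_apply, basisVec_apply, smul_eq_mul]
    by_cases hT : q ∈ T
    · rw [if_pos hT]
      by_cases h : T.erase q = S
      · subst h
        rw [Finset.insert_erase hT, if_pos rfl, if_pos rfl, jwSign_erase_self]
      · rw [if_neg h, if_neg, mul_zero, mul_zero]
        rintro rfl
        exact h (Finset.erase_insert hS)
    · rw [if_neg hT, if_neg, mul_zero]
      rintro rfl
      exact hT (Finset.mem_insert_self _ _)

theorem ann_mul_ann (q q' : ι) : ann q * ann q' + ann q' * ann q = 0 := by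
  ext f S
  change ann q (ann q' f) S + ann q' (ann q f) S = 0
  rw [ann_apply, ann_apply, ann_apply, ann_apply]
  by_cases hqq : q = q'
  · subst hqq; simp
  by_cases h : q ∈ S
  · simp [h]
  by_cases h' : q' ∈ S
  · simp [h']
  rw [if_neg h, if_neg h', if_neg, if_neg, Finset.insert_comm q' q, ← mul_assoc, ← mul_assoc,
    ← add_mul, jwSign_exchange hqq h h', zero_mul]
  · simp [h, hqq]
  · simp [h', Ne.symm hqq]

theorem ann_mul_adjoint_ann (q q' : ι) :
    ann q * star (ann q') + star (ann q') * ann q = if q = q' then 1 else 0 := by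
  ext f S
  change ann q (star (ann q') f) S + star (ann q') (ann q f) S = _
  rw [ann_apply, adjoint_ann_apply, adjoint_ann_apply, ann_apply]
  by_cases hqq : q = q'
  · subst hqq
    rw [if_pos rfl, if_pos (Finset.mem_insert_self _ _), if_neg (Finset.notMem_erase _ _)]
    by_cases h : q ∈ S
    · rw [if_pos h, if_pos h, zero_add, jwSign_erase_self, Finset.insert_erase h, ← mul_assoc,
        jwSign_mul_self, one_mul]
      rfl
    · rw [if_neg h, if_neg h, add_zero, Finset.erase_insert h, ← mul_assoc,
        ← jwSign_erase_self q (insert q S), Finset.erase_insert h, jwSign_mul_self, one_mul]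
      rfl
  · rw [if_neg hqq]
    change _ = (0 : ℂ)
    by_cases h' : q' ∈ S
    · by_cases h : q ∈ S
      · simp [h, hqq]
      · obtain ⟨U, hU, rfl⟩ : ∃ U, q' ∉ U ∧ insert q' U = S :=
          ⟨S.erase q', Finset.notMem_erase _ _, Finset.insert_erase h'⟩
        have hq : q ∉ U := fun hq => h (Finset.mem_insert_of_mem hq)
        rw [if_neg h, if_pos (Finset.mem_insert_of_mem h'), if_pos h', Finset.erase_insert hU,
          if_neg hq, Finset.insert_comm q q', Finset.erase_insert (by simp [hU, Ne.symm hqq]),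
          ← jwSign_erase_self q' (insert q' U), Finset.erase_insert hU,
          ← jwSign_erase_self q' (insert q' (insert q U)),
          Finset.erase_insert (by simp [hU, Ne.symm hqq]), ← mul_assoc, ← mul_assoc, ← add_mul,
          jwSign_exchange' hqq hq hU, zero_mul]
    · simp [h', Ne.symm hqq]

theorem ann_mem_finiteVectors (q : ι) {f : FermionFock ι} (hf : f ∈ finiteVectors ι) :
    ann q f ∈ finiteVectors ι := by
  induction hf using Submodule.span_induction with
  | mem x hx =>
    obtain ⟨S, rfl⟩ := hx
    rw [ann_basisVec]
    split_ifs
    · exact Submodule.smul_mem _ _ (basisVec_mem _)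
    · exact Submodule.zero_mem _
  | zero => rw [map_zero]; exact Submodule.zero_mem _
  | add x y _ _ hx hy => rw [map_add]; exact Submodule.add_mem _ hx hy
  | smul c x _ hx => rw [map_smul]; exact Submodule.smul_mem _ _ hx

theorem adjoint_ann_mem_finiteVectors (q : ι) {f : FermionFock ι} (hf : f ∈ finiteVectors ι) :
    star (ann q) f ∈ finiteVectors ι := by
  induction hf using Submodule.span_induction with
  | mem x hx =>
    obtain ⟨S, rfl⟩ := hx
    rw [adjoint_ann_basisVec]
    split_ifs
    · exact Submodule.zero_mem _
    · exact Submodule.smul_mem _ _ (basisVec_mem _)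
  | zero => rw [map_zero]; exact Submodule.zero_mem _
  | add x y _ _ hx hy => rw [map_add]; exact Submodule.add_mem _ hx hy
  | smul c x _ hx => rw [map_smul]; exact Submodule.smul_mem _ _ hx

end FermionFock

/-! ### Quadratic expressions in canonical anticommutation relations -/

/-- The canonical anticommutation relations of annihilators `c` and creators `c'`. -/
structure IsCAR {ι A : Type*} [DecidableEq ι] [Ring A] (c c' : ι → A) : Prop where
  ann_ann : ∀ i j, c i * c j = -(c j * c i)
  cre_cre : ∀ i j, c' i * c' j = -(c' j * c' i)
  ann_cre : ∀ i j, c i * c' j = (if i = j then 1 else 0) - c' j * c i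

section CAR

variable {ι A : Type*} [Ring A] [Algebra ℂ A]

/-- The bilinear `∑ B i j c'ᵢ cⱼ` over a finite set of modes. -/
def quad (W : Finset ι) (c c' : ι → A) (B : ι → ι → ℂ) : A :=
  ∑ i ∈ W, ∑ j ∈ W, B i j • (c' i * c j)

/-- The quartic expression `∑ T i j k l c'ᵢ c'ₖ cₗ cⱼ` over a finite set of modes. -/
def quartic (W : Finset ι) (c c' : ι → A) (T : ι → ι → ι → ι → ℂ) : A :=
  ∑ i ∈ W, ∑ j ∈ W, ∑ k ∈ W, ∑ l ∈ W, T i j k l • (c' i * c' k * (c l * c j))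

variable {c c' : ι → A} (W : Finset ι)

theorem quartic_add (T U : ι → ι → ι → ι → ℂ) :
    quartic W c c' (fun i j k l => T i j k l + U i j k l) =
      quartic W c c' T + quartic W c c' U := by
  simp only [quartic, add_smul, Finset.sum_add_distrib]

theorem quad_add (B C : ι → ι → ℂ) :
    quad W c c' (fun i j => B i j + C i j) = quad W c c' B + quad W c c' C := by
  simp only [quad, add_smul, Finset.sum_add_distrib]

theorem quartic_sum {κ : Type*} (P : Finset κ) (T : κ → ι → ι → ι → ι → ℂ) :
    quartic W c c' (fun i j k l => ∑ p ∈ P, T p i j k l) = ∑ p ∈ P, quartic W c c' (T p) := by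
  classical
  induction P using Finset.induction_on with
  | empty => simp [quartic]
  | insert p P hp ih =>
    simp only [Finset.sum_insert hp]
    rw [quartic_add, ih]

theorem quad_sum {κ : Type*} (P : Finset κ) (B : κ → ι → ι → ℂ) :
    quad W c c' (fun i j => ∑ p ∈ P, B p i j) = ∑ p ∈ P, quad W c c' (B p) := by
  classical
  induction P using Finset.induction_on with
  | empty => simp [quad]
  | insert p P hp ih =>
    simp only [Finset.sum_insert hp]
    rw [quad_add, ih]

theorem quartic_congr {T U : ι → ι → ι → ι → ℂ}
    (h : ∀ i ∈ W, ∀ j ∈ W, ∀ k ∈ W, ∀ l ∈ W, T i j k l = U i j k l) :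
    quartic W c c' T = quartic W c c' U :=
  Finset.sum_congr rfl fun i hi => Finset.sum_congr rfl fun j hj =>
    Finset.sum_congr rfl fun k hk => Finset.sum_congr rfl fun l hl => by rw [h i hi j hj k hk l hl]

variable [DecidableEq ι]

/-- Moving `c j` to the right past `c' k` leaves the contraction at `j = k`; the sign of the
remainder is absorbed by exchanging the two annihilators. -/
theorem IsCAR.quad_mul_quad (h : IsCAR c c') (B C : ι → ι → ℂ) :
    quad W c c' B * quad W c c' C =
      quad W c c' (fun i l => ∑ j ∈ W, B i j * C j l) +
        quartic W c c' (fun i j k l => B i j * C k l) := by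
  have key : ∀ i j k l, B i j • (c' i * c j) * C k l • (c' k * c l) =
      (if j = k then (B i j * C k l) • (c' i * c l) else 0) +
        (B i j * C k l) • (c' i * c' k * (c l * c j)) := by
    intro i j k l
    rw [smul_mul_smul_comm]
    have : c' i * c j * (c' k * c l) = c' i * (c j * c' k) * c l := by noncomm_ring
    rw [this, h.ann_cre, h.ann_ann l j]
    split_ifs
    · rw [← smul_add]; congr 1; noncomm_ring
    · rw [zero_add]; congr 1; noncomm_ring
  unfold quad quartic
  simp only [Finset.sum_mul]
  simp only [Finset.mul_sum, key, Finset.sum_add_distrib]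
  congr 1
  refine Finset.sum_congr rfl fun i _ => ?_
  simp only [Finset.sum_smul]
  rw [Finset.sum_comm (s := W) (t := W) (f := fun l j => (B i j * C j l) • (c' i * c l))]
  refine Finset.sum_congr rfl fun j hj => ?_
  rw [Finset.sum_comm]
  refine Finset.sum_congr rfl fun l _ => ?_
  rw [Finset.sum_ite_eq, if_pos hj]

theorem IsCAR.quartic_flip (h : IsCAR c c') (T : ι → ι → ι → ι → ℂ) :
    quartic W c c' (fun i j k l => T k l i j) = quartic W c c' T := by
  unfold quartic
  have e : ∀ i j k l, c' i * c' k * (c l * c j) = c' k * c' i * (c j * c l) := by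
    intro i j k l
    rw [h.cre_cre i k, h.ann_ann l j, neg_mul_neg]
  calc _ = ∑ i ∈ W, ∑ k ∈ W, ∑ j ∈ W, ∑ l ∈ W, T k l i j • (c' k * c' i * (c j * c l)) := by
        refine Finset.sum_congr rfl fun i _ => ?_
        rw [Finset.sum_comm]
        simp only [e]
    _ = ∑ k ∈ W, ∑ i ∈ W, ∑ l ∈ W, ∑ j ∈ W, T k l i j • (c' k * c' i * (c j * c l)) := by
        rw [Finset.sum_comm]
        refine Finset.sum_congr rfl fun k _ => Finset.sum_congr rfl fun i _ => ?_
        rw [Finset.sum_comm]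
    _ = _ := by
        refine Finset.sum_congr rfl fun k _ => ?_
        rw [Finset.sum_comm]

theorem IsCAR.quartic_swap (h : IsCAR c c') (T : ι → ι → ι → ι → ℂ) :
    quartic W c c' (fun i j k l => T i l k j) = -quartic W c c' T := by
  unfold quartic
  rw [← Finset.sum_neg_distrib]
  refine Finset.sum_congr rfl fun i _ => ?_
  rw [← Finset.sum_neg_distrib]
  calc _ = ∑ j ∈ W, ∑ l ∈ W, ∑ k ∈ W, T i l k j • (c' i * c' k * (c l * c j)) :=
        Finset.sum_congr rfl fun j _ => Finset.sum_comm
    _ = ∑ l ∈ W, ∑ j ∈ W, ∑ k ∈ W, T i l k j • (c' i * c' k * (c l * c j)) := Finset.sum_comm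
    _ = _ := by
        refine Finset.sum_congr rfl fun l _ => ?_
        rw [Finset.sum_comm]
        simp only [← Finset.sum_neg_distrib]
        refine Finset.sum_congr rfl fun k _ => Finset.sum_congr rfl fun j _ => ?_
        rw [h.ann_ann l j, mul_neg, smul_neg]

/-- By the anticommutation relations, a quartic expression vanishes if its symmetrised coefficients
are symmetric under exchange of the annihilators. -/
theorem IsCAR.quartic_eq_zero (h : IsCAR c c') (T : ι → ι → ι → ι → ℂ)
    (hT : ∀ i ∈ W, ∀ j ∈ W, ∀ k ∈ W, ∀ l ∈ W,
      T i j k l + T k l i j = T i l k j + T k j i l) : quartic W c c' T = 0 := by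
  have h1 := quartic_congr (c := c) (c' := c') W hT
  have h2 := h.quartic_flip W T
  have h3 := h.quartic_swap W T
  have h4 := h.quartic_swap W (fun i j k l => T k l i j)
  rw [quartic_add, quartic_add, h2, h3, h4, h2] at h1
  -- The flip preserves the quartic expression and the swap negates it, so the hypothesis on `T`
  -- sums to $2Q=-2Q$.
  have h5 : (4 : ℂ) • quartic W c c' T = 0 := by
    have : (4 : ℂ) • quartic W c c' T = (quartic W c c' T + quartic W c c' T) -
        (-quartic W c c' T + -quartic W c c' T) := by module
    rw [this, h1, sub_self]
  exact (smul_eq_zero_iff_right (by norm_num)).1 h5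

/-- Only the tensor summed over `p` has to satisfy the symmetry; the individual products have
nonzero quartic parts in general. -/
theorem IsCAR.sum_quad_mul_quad (h : IsCAR c c') {κ : Type*} (P : Finset κ)
    (B C : κ → ι → ι → ℂ) (T : ι → ι → ι → ι → ℂ) (G : ι → ℂ)
    (hBC : ∀ i ∈ W, ∀ j ∈ W, ∀ k ∈ W, ∀ l ∈ W, ∑ p ∈ P, B p i j * C p k l = T i j k l)
    (hT : ∀ i ∈ W, ∀ j ∈ W, ∀ k ∈ W, ∀ l ∈ W,
      T i j k l + T k l i j = T i l k j + T k j i l)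
    (hG : ∀ i ∈ W, ∀ l ∈ W, ∑ j ∈ W, T i j j l = if i = l then G i else 0) :
    ∑ p ∈ P, quad W c c' (B p) * quad W c c' (C p) = ∑ i ∈ W, G i • (c' i * c i) := by
  simp only [h.quad_mul_quad, Finset.sum_add_distrib]
  rw [← quartic_sum, quartic_congr W hBC, h.quartic_eq_zero W T hT, add_zero, ← quad_sum]
  refine Finset.sum_congr rfl fun i hi => ?_
  have : ∀ l ∈ W, (∑ p ∈ P, ∑ j ∈ W, B p i j * C p j l) • (c' i * c l) =
      if i = l then G i • (c' i * c l) else 0 := by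
    intro l hl
    rw [Finset.sum_comm, Finset.sum_congr rfl fun j hj => hBC i hi j hj j hj l hl, hG i hi l hl]
    split_ifs
    · rfl
    · rw [zero_smul]
  rw [Finset.sum_congr rfl this, Finset.sum_ite_eq, if_pos hi]

end CAR

/-! ### The truncated Kronig identity -/

/-- Spin, longitudinal and transverse coordinates of a mode. -/
abbrev Site (M : ℕ) : Type := ℤˣ × ℤ × ZMod M

namespace Site

variable {M : ℕ}

/-- The matrix which shifts the longitudinal coordinate by `q`, the transverse one by `t`, and acts
by `V` on the spin. -/
def hop (V : ℤˣ → ℤˣ → ℂ) (q : ℤ) (t : ZMod M) (x y : Site M) : ℂ :=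
  if y.2.1 = x.2.1 + q ∧ y.2.2 = x.2.2 + t then V x.1 y.1 else 0

/-- The factorisation isolates total momentum conservation, which is free of `q` and `t`, from two
indicators selecting the transfer; the sums over `q` and `t` can then be carried out. -/
theorem hop_mul_hop (V : ℤˣ → ℤˣ → ℂ) (q : ℤ) (t : ZMod M) (x y k l : Site M) :
    hop V (-q) (-t) x y * hop V q t k l =
      V x.1 y.1 * V k.1 l.1 *
        (if x.2.1 + k.2.1 = y.2.1 + l.2.1 ∧ x.2.2 + k.2.2 = y.2.2 + l.2.2 then 1 else 0) *
        (if x.2.1 - y.2.1 = q then 1 else 0) * (if x.2.2 - y.2.2 = t then 1 else 0) := by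
  unfold hop
  by_cases hq : x.2.1 - y.2.1 = q
  · by_cases ht : x.2.2 - y.2.2 = t
    · have h1 : y.2.1 = x.2.1 + -q ∧ y.2.2 = x.2.2 + -t := ⟨by omega, by rw [← ht]; ring⟩
      rw [if_pos h1, if_pos hq, if_pos ht]
      by_cases h2 : x.2.1 + k.2.1 = y.2.1 + l.2.1 ∧ x.2.2 + k.2.2 = y.2.2 + l.2.2
      · rw [if_pos h2, if_pos ⟨by omega, by linear_combination (-1 : ZMod M) * h2.2 + ht⟩]
        ring
      · rw [if_neg h2, if_neg]
        · ring
        · rintro ⟨h3, h4⟩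
          exact h2 ⟨by omega, by linear_combination (-1 : ZMod M) * h4 + ht⟩
    · rw [if_neg ht, if_neg]
      · ring
      · rintro ⟨h3, h4⟩
        exact ht (by rw [h4]; ring)
  · rw [if_neg hq, if_neg]
    · ring
    · rintro ⟨h3, h4⟩
      omega

/-- Indicator of the Dirac sea. -/
def sea (x : Site M) : ℂ := if x.2.1 < 0 then 1 else 0

theorem sea_mk (α : ℤˣ) (m : ℤ) (t : ZMod M) :
    sea (α, m, t) = if m < 0 then 1 else 0 := rfl

variable [NeZero M]

/-- The sites with longitudinal coordinate in `[-N, N)`. -/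
noncomputable def window (M N : ℕ) [NeZero M] : Finset (Site M) :=
  Finset.univ ×ˢ (Finset.Ico (-N : ℤ) N ×ˢ Finset.univ)

theorem mem_window {N : ℕ} {x : Site M} : x ∈ window M N ↔ -(N : ℤ) ≤ x.2.1 ∧ x.2.1 < N := by
  unfold window
  rw [Finset.mem_product, Finset.mem_product, Finset.mem_Ico]
  exact ⟨fun h => h.2.1, fun h => ⟨Finset.mem_univ _, h, Finset.mem_univ _⟩⟩

/-- The number of integers with absolute value `d`. -/
def absCount (d : ℤ) : ℂ := if 0 < d then 2 else if d = 0 then 1 else 0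

theorem sum_abs_eq {d : ℤ} {Q : ℕ} (hd : |d| < Q) :
    ∑ q ∈ Finset.Ioo (-Q : ℤ) Q, (if d = |q| then (1 : ℂ) else 0) = absCount d := by
  rw [abs_lt] at hd
  rw [Finset.sum_boole, absCount]
  rcases lt_trichotomy d 0 with h | h | h
  · rw [if_neg (by omega), if_neg (by omega), Finset.filter_eq_empty_iff.2]
    · simp
    · intro q _ hq
      have := abs_nonneg q
      omega
  · have : (Finset.Ioo (-Q : ℤ) Q).filter (fun q => d = |q|) = {0} := by
      ext q
      simp only [Finset.mem_filter, Finset.mem_Ioo, Finset.mem_singleton, h]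
      rw [eq_comm, abs_eq_zero]
      exact ⟨fun h => h.2, fun h => ⟨by omega, h⟩⟩
    rw [this, if_neg (by omega), if_pos h]
    simp
  · have : (Finset.Ioo (-Q : ℤ) Q).filter (fun q => d = |q|) = {d, -d} := by
      ext q
      simp only [Finset.mem_filter, Finset.mem_Ioo, Finset.mem_singleton, Finset.mem_insert]
      rw [eq_comm, abs_eq h.le]
      exact ⟨fun h => h.2, fun h => ⟨by omega, h⟩⟩
    rw [this, if_pos h, Finset.card_pair (by omega)]
    norm_num

/-- This is the effect of boson ordering: after symmetrisation the weight no longer depends on the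
transfer. -/
theorem absCount_add_neg (d : ℤ) : absCount d + absCount (-d) = 2 := by
  unfold absCount
  rcases lt_trichotomy d 0 with h | h | h
  · rw [if_neg (by omega), if_neg (by omega), if_pos (by omega)]; norm_num
  · subst h; norm_num
  · rw [if_pos h, if_neg (by omega), if_neg (by omega)]; norm_num

/-- Each of the `m + N` sites below `m` counts twice, `m` itself once, and those above not at all.
-/
theorem sum_absCount {N : ℕ} {m : ℤ} (h : -(N : ℤ) ≤ m) (h' : m < N) :
    ∑ l ∈ Finset.Ico (-N : ℤ) N, absCount (m - l) = 2 * (m + N) + 1 := by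
  have : ∀ l, absCount (m - l) = 2 * (if l < m then 1 else 0) + if m = l then 1 else 0 := by
    intro l
    unfold absCount
    rcases lt_trichotomy l m with h | h | h
    · rw [if_pos (by omega), if_pos h, if_neg (by omega)]; norm_num
    · rw [if_neg (by omega), if_pos (by omega), if_neg (by omega), if_pos (by omega)]; norm_num
    · rw [if_neg (by omega), if_neg (by omega), if_neg (by omega), if_neg (by omega)]; norm_num
  simp only [this, Finset.sum_add_distrib, ← Finset.mul_sum]
  rw [Finset.sum_boole, Finset.sum_ite_eq, if_pos (Finset.mem_Ico.2 ⟨h, h'⟩)]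
  have hf : (Finset.Ico (-N : ℤ) N).filter (fun l => l < m) = Finset.Ico (-N : ℤ) m := by
    ext l
    simp only [Finset.mem_filter, Finset.mem_Ico]
    omega
  rw [hf, Int.card_Ico]
  have : (((m - -(N : ℤ)).toNat : ℤ) : ℂ) = ((m + N : ℤ) : ℂ) := by
    congr 1
    omega
  push_cast at this
  rw [this]

/-- The trace of a spin matrix. -/
def spinTrace (U : ℤˣ → ℤˣ → ℂ) : ℂ := ∑ α, U α α

variable {A κ : Type*} [Ring A] [Algebra ℂ A] [Fintype κ]

/-- Weighted spin matrices whose tensor square is symmetric and whose square is the identity. -/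
structure IsSpinResolution (w : κ → ℂ) (V : κ → ℤˣ → ℤˣ → ℂ) : Prop where
  symm : ∀ α δ β γ, ∑ i, w i * (V i α δ * V i β γ) = ∑ i, w i * (V i α γ * V i β δ)
  one : ∀ α γ, ∑ i, w i * (∑ δ, V i α δ * V i δ γ) = if α = γ then 1 else 0

variable {w : κ → ℂ} {V : κ → ℤˣ → ℤˣ → ℂ}

theorem IsSpinResolution.contract (h : IsSpinResolution w V) (α γ : ℤˣ) :
    ∑ δ, ∑ i, w i * (V i α δ * V i δ γ) = if α = γ then 1 else 0 := by
  rw [← h.one, Finset.sum_comm]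
  simp only [Finset.mul_sum]

/-- For equal inner indices the symmetry turns a matrix product into trace times matrix. -/
theorem IsSpinResolution.trace_mul (h : IsSpinResolution w V) (α γ : ℤˣ) :
    ∑ i, w i * (spinTrace (V i) * V i α γ) = if α = γ then 1 else 0 := by
  rw [← h.contract]
  simp only [h.symm α _ _ γ]
  rw [Finset.sum_comm]
  refine Finset.sum_congr rfl fun i _ => ?_
  rw [spinTrace, Finset.sum_mul, Finset.mul_sum]
  refine Finset.sum_congr rfl fun δ _ => ?_
  ring

theorem IsSpinResolution.trace_sq (h : IsSpinResolution w V) :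
    ∑ i, w i * spinTrace (V i) ^ 2 = 2 := by
  have : ∑ α : ℤˣ, ∑ i, w i * (spinTrace (V i) * V i α α) = 2 := by
    simp [h.trace_mul]
  rw [← this, Finset.sum_comm]
  refine Finset.sum_congr rfl fun i _ => ?_
  rw [← Finset.mul_sum, ← Finset.mul_sum, sq]
  rfl

theorem sum_window (N : ℕ) {B : Type*} [AddCommMonoid B] (f : Site M → B) :
    ∑ x ∈ window M N, f x = ∑ α, ∑ m ∈ Finset.Ico (-N : ℤ) N, ∑ t, f (α, m, t) := by
  unfold window
  rw [Finset.sum_product]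
  refine Finset.sum_congr rfl fun α _ => ?_
  rw [Finset.sum_product]

/-- The Kronig identity before vacuum subtraction; the dependence of the coefficient on `N` is the
contribution of the filled sea. -/
theorem sum_quad_hop {c c' : Site M → A} (hc : IsCAR c c') (hV : IsSpinResolution w V)
    {N Q : ℕ} (hQ : 2 * N ≤ Q) :
    ∑ i, w i • ∑ q ∈ Finset.Ioo (-Q : ℤ) Q, ∑ t,
        quad (window M N) c c' (hop (V i) (-|q|) (-t)) * quad (window M N) c c' (hop (V i) |q| t) =
      ∑ x ∈ window M N, ((M : ℂ) * (2 * (x.2.1 + N) + 1)) • (c' x * c x) := by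
  have key := hc.sum_quad_mul_quad (window M N)
    (Finset.univ ×ˢ (Finset.Ioo (-Q : ℤ) Q ×ˢ (Finset.univ : Finset (ZMod M))))
    (fun p x y => w p.1 * hop (V p.1) (-|p.2.1|) (-p.2.2) x y)
    (fun p => hop (V p.1) |p.2.1| p.2.2)
    (fun x y k l => (∑ i, w i * (V i x.1 y.1 * V i k.1 l.1)) *
      (if x.2.1 + k.2.1 = y.2.1 + l.2.1 ∧ x.2.2 + k.2.2 = y.2.2 + l.2.2 then 1 else 0) *
      absCount (x.2.1 - y.2.1))
    (fun x => (M : ℂ) * (2 * (x.2.1 + N) + 1)) ?_ ?_ ?_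
  · rw [← key, Finset.sum_product]
    refine Finset.sum_congr rfl fun i _ => ?_
    rw [Finset.sum_product, Finset.smul_sum]
    refine Finset.sum_congr rfl fun q _ => ?_
    rw [Finset.smul_sum]
    refine Finset.sum_congr rfl fun t _ => ?_
    rw [← smul_mul_assoc]
    congr 1
    simp only [quad, Finset.smul_sum, smul_smul]
  · intro x hx y hy k hk l hl
    rw [mem_window] at hx hy
    rw [Finset.sum_product, Finset.sum_mul, Finset.sum_mul]
    refine Finset.sum_congr rfl fun i _ => ?_
    rw [Finset.sum_product, ← sum_abs_eq (Q := Q) (abs_lt.2 ⟨by omega, by omega⟩), Finset.mul_sum]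
    refine Finset.sum_congr rfl fun q _ => ?_
    simp only [mul_assoc (w i), hop_mul_hop]
    rw [← Finset.mul_sum, ← Finset.mul_sum, Finset.sum_ite_eq, if_pos (Finset.mem_univ _)]
    ring
  · intro x hx y hy k hk l hl
    have e1 : ∑ i, w i * (V i k.1 l.1 * V i x.1 y.1) = ∑ i, w i * (V i x.1 y.1 * V i k.1 l.1) :=
      Finset.sum_congr rfl fun i _ => by ring
    have e2 : ∑ i, w i * (V i k.1 y.1 * V i x.1 l.1) = ∑ i, w i * (V i x.1 y.1 * V i k.1 l.1) := by
      rw [hV.symm x.1]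
      exact Finset.sum_congr rfl fun i _ => by ring
    -- All four spin tensors are now the same, and only the momentum weights remain to be compared.
    rw [e1, e2, hV.symm x.1 l.1]
    by_cases hC : x.2.1 + k.2.1 = y.2.1 + l.2.1 ∧ x.2.2 + k.2.2 = y.2.2 + l.2.2
    · have hC2 : k.2.1 + x.2.1 = l.2.1 + y.2.1 ∧ k.2.2 + x.2.2 = l.2.2 + y.2.2 :=
        ⟨by omega, by linear_combination hC.2⟩
      have hC3 : x.2.1 + k.2.1 = l.2.1 + y.2.1 ∧ x.2.2 + k.2.2 = l.2.2 + y.2.2 :=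
        ⟨by omega, by linear_combination hC.2⟩
      have hC4 : k.2.1 + x.2.1 = y.2.1 + l.2.1 ∧ k.2.2 + x.2.2 = y.2.2 + l.2.2 :=
        ⟨by omega, by linear_combination hC.2⟩
      rw [if_pos hC, if_pos hC2, if_pos hC3, if_pos hC4, ← mul_add, ← mul_add,
        show k.2.1 - l.2.1 = -(x.2.1 - y.2.1) by omega, absCount_add_neg,
        show k.2.1 - y.2.1 = -(x.2.1 - l.2.1) by omega, absCount_add_neg]
    · have hC2 : ¬(k.2.1 + x.2.1 = l.2.1 + y.2.1 ∧ k.2.2 + x.2.2 = l.2.2 + y.2.2) :=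
        fun h => hC ⟨by omega, by linear_combination h.2⟩
      have hC3 : ¬(x.2.1 + k.2.1 = l.2.1 + y.2.1 ∧ x.2.2 + k.2.2 = l.2.2 + y.2.2) :=
        fun h => hC ⟨by omega, by linear_combination h.2⟩
      have hC4 : ¬(k.2.1 + x.2.1 = y.2.1 + l.2.1 ∧ k.2.2 + x.2.2 = y.2.2 + l.2.2) :=
        fun h => hC ⟨by omega, by linear_combination h.2⟩
      rw [if_neg hC, if_neg hC2, if_neg hC3, if_neg hC4]
      ring
  · intro x hx l hl
    rw [mem_window] at hx
    have : ∀ y : Site M, (x.2.1 + y.2.1 = y.2.1 + l.2.1 ∧ x.2.2 + y.2.2 = y.2.2 + l.2.2) ↔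
        x.2 = l.2 := fun y => by
      rw [Prod.ext_iff, add_comm, add_left_cancel_iff, add_comm x.2.2, add_left_cancel_iff]
    simp only [this]
    rw [sum_window]
    simp only [Finset.sum_const, Finset.card_univ, ZMod.card, nsmul_eq_mul, ← Finset.mul_sum,
      sum_absCount hx.1 hx.2]
    rw [← Finset.sum_mul, ← Finset.sum_mul, hV.contract]
    by_cases h1 : x.1 = l.1
    · by_cases h2 : x.2 = l.2
      · rw [if_pos h1, if_pos h2, if_pos (Prod.ext h1 h2)]; ring
      · rw [if_neg h2, if_neg fun h => h2 (congrArg Prod.snd h)]; ring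
    · rw [if_neg h1, if_neg fun h => h1 (congrArg Prod.fst h)]; ring

/-- The normal ordered bilinear of the modes `x` and `y`. -/
def bilin (c c' : Site M → A) (x y : Site M) : A :=
  c' x * c y - (if x = y then sea x else 0) • (1 : A)

/-- The normal ordered quadratic expression with coefficients `B`. -/
noncomputable def nquad (N : ℕ) (c c' : Site M → A) (B : Site M → Site M → ℂ) : A :=
  ∑ x ∈ window M N, ∑ y ∈ window M N, B x y • bilin c c' x y

theorem nquad_eq (N : ℕ) (c c' : Site M → A) (B : Site M → Site M → ℂ) :
    nquad N c c' B = quad (window M N) c c' B - (∑ x ∈ window M N, B x x * sea x) • (1 : A) := by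
  unfold nquad quad bilin
  rw [Finset.sum_smul, ← Finset.sum_sub_distrib]
  refine Finset.sum_congr rfl fun x hx => ?_
  simp only [smul_sub, Finset.sum_sub_distrib, smul_smul, ite_smul, zero_smul, smul_ite,
    smul_zero]
  rw [Finset.sum_ite_eq, if_pos hx]

theorem sum_sea {N : ℕ} (f : ℤ → ℂ) :
    ∑ m ∈ Finset.Ico (-N : ℤ) N, f m * (if m < 0 then 1 else 0) = ∑ j ∈ Finset.range N, f (-j - 1) := by
  simp only [mul_ite, mul_one, mul_zero]
  rw [← Finset.sum_filter]
  symm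
  refine Finset.sum_bij (fun j _ => -(j : ℤ) - 1) ?_ ?_ ?_ ?_
  · intro j hj
    rw [Finset.mem_range] at hj
    rw [Finset.mem_filter, Finset.mem_Ico]
    omega
  · intro j _ j' _ h
    omega
  · intro m hm
    rw [Finset.mem_filter, Finset.mem_Ico] at hm
    exact ⟨(-m - 1).toNat, by rw [Finset.mem_range]; omega, by omega⟩
  · intro j _
    rfl

theorem sum_hop_diag (U : ℤˣ → ℤˣ → ℂ) (N : ℕ) (q : ℤ) (t : ZMod M) :
    ∑ x ∈ window M N, hop U q t x x * sea x = if q = 0 ∧ t = 0 then spinTrace U * (M * N) else 0 := by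
  have h1 : ∀ x : Site M, hop U q t x x = if q = 0 ∧ t = 0 then U x.1 x.1 else 0 := fun x => by
    simp only [hop, left_eq_add]
  simp only [h1]
  split_ifs
  · rw [sum_window, spinTrace, Finset.sum_mul]
    refine Finset.sum_congr rfl fun α _ => ?_
    simp only [sea_mk, Finset.sum_const, Finset.card_univ, ZMod.card, nsmul_eq_mul]
    rw [← Finset.mul_sum, sum_sea (fun _ => U α α)]
    simp
    ring
  · simp

theorem sum_energy_sea (N : ℕ) :
    ∑ x ∈ window M N, ((x.2.1 : ℂ) + 1 / 2) * sea x = -(M * N ^ 2) := by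
  rw [sum_window]
  simp only [sea_mk, Finset.sum_const, Finset.card_univ, ZMod.card, nsmul_eq_mul]
  simp only [mul_left_comm _ (M : ℂ), ← Finset.mul_sum]
  rw [sum_sea (fun m => (m : ℂ) + 1 / 2)]
  have : ∑ j ∈ Finset.range N, (((-(j : ℤ) - 1 : ℤ) : ℂ) + 1 / 2) = -(N : ℂ) ^ 2 / 2 := by
    induction N with
    | zero => simp
    | succ n ih =>
      rw [Finset.sum_range_succ, ih]
      push_cast
      ring
  rw [this]
  simp
  ring

/-- The two-dimensional Kronig identity for the modes in a window. -/
theorem sum_nquad_hop {c c' : Site M → A} (hc : IsCAR c c') (hV : IsSpinResolution w V)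
    {N Q : ℕ} (hQ : 2 * N ≤ Q) (hQ0 : 0 < Q) :
    ∑ i, w i • ∑ q ∈ Finset.Ioo (-Q : ℤ) Q, ∑ t,
        nquad N c c' (hop (V i) (-|q|) (-t)) * nquad N c c' (hop (V i) |q| t) =
      (2 * M : ℂ) • ∑ x ∈ window M N, ((x.2.1 : ℂ) + 1 / 2) • bilin c c' x x := by
  -- The vacuum subtraction is nonzero only at zero momentum, where the sea contributes `M * N`
  -- sites per spin.
  have hterm : ∀ i q (t : ZMod M),
      nquad N c c' (hop (V i) (-|q|) (-t)) * nquad N c c' (hop (V i) |q| t) =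
        quad (window M N) c c' (hop (V i) (-|q|) (-t)) * quad (window M N) c c' (hop (V i) |q| t) +
          if 0 = q then (if 0 = t then
            (-2 * (spinTrace (V i) * (M * N))) • quad (window M N) c c' (hop (V i) 0 0) +
              (spinTrace (V i) * (M * N)) ^ 2 • (1 : A) else 0) else 0 := by
    intro i q t
    rw [nquad_eq, nquad_eq, sum_hop_diag, sum_hop_diag]
    by_cases hq : q = 0
    · by_cases ht : t = 0
      · subst hq ht
        simp only [abs_zero, neg_zero, and_self, if_true]
        simp only [sub_mul, mul_sub, smul_mul_assoc, mul_smul_comm, one_mul, mul_one]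
        module
      · simp [hq, ht, Ne.symm ht]
    · simp [hq, Ne.symm hq]
  simp only [hterm, Finset.sum_add_distrib, smul_add, sum_quad_hop hc hV hQ]
  -- By `trace_mul` the cross terms reduce to $-2MN$ times the total occupation, which removes the
  -- $2MN$ from $M(2(l+N)+1)$.
  have hlin : ∑ i, w i • ((-2 * (spinTrace (V i) * (M * N))) • quad (window M N) c c' (hop (V i) 0 0)) =
      (-2 * (M * N) : ℂ) • ∑ x ∈ window M N, c' x * c x := by
    have : ∀ i, w i • ((-2 * (spinTrace (V i) * (M * N))) • quad (window M N) c c' (hop (V i) 0 0)) =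
        (-2 * (M * N) : ℂ) • quad (window M N) c c'
          (fun x y => w i * (spinTrace (V i) * hop (V i) 0 0 x y)) := by
      intro i
      simp only [quad, Finset.smul_sum, smul_smul]
      refine Finset.sum_congr rfl fun x _ => Finset.sum_congr rfl fun y _ => ?_
      congr 1
      ring
    simp only [this]
    rw [← Finset.smul_sum, ← quad_sum]
    congr 1
    refine Finset.sum_congr rfl fun x hx => ?_
    have h1 : ∀ y, ∑ i, w i * (spinTrace (V i) * hop (V i) 0 0 x y) = if x = y then 1 else 0 := by
      intro y
      unfold hop
      by_cases h2 : x.2 = y.2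
      · have h3 : y.2.1 = x.2.1 + 0 ∧ y.2.2 = x.2.2 + 0 := by simp [h2]
        have h4 : x = y ↔ x.1 = y.1 := ⟨congrArg Prod.fst, fun h => Prod.ext h h2⟩
        simp only [if_pos h3, hV.trace_mul, h4]
      · have h3 : ¬(y.2.1 = x.2.1 + 0 ∧ y.2.2 = x.2.2 + 0) := by
          rintro ⟨h4, h5⟩
          exact h2 (Prod.ext (by omega) (by rw [h5, add_zero]))
        rw [if_neg fun h => h2 (congrArg Prod.snd h)]
        simp only [if_neg h3, mul_zero, Finset.sum_const_zero]
    simp only [h1, ite_smul, one_smul, zero_smul]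
    rw [Finset.sum_ite_eq, if_pos hx]
  have hconst : ∑ i, w i • ((spinTrace (V i) * (M * N)) ^ 2 • (1 : A)) =
      (2 * (M * N) ^ 2 : ℂ) • (1 : A) := by
    simp only [smul_smul]
    rw [← Finset.sum_smul, ← hV.trace_sq, Finset.sum_mul]
    congr 1
    exact Finset.sum_congr rfl fun i _ => by ring
  have h0 : (0 : ℤ) ∈ Finset.Ioo (-Q : ℤ) Q := by rw [Finset.mem_Ioo]; omega
  simp only [Finset.sum_ite_irrel, Finset.sum_const_zero, Finset.sum_ite_eq, Finset.mem_univ, h0,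
    if_true, smul_add, Finset.sum_add_distrib]
  rw [hlin, hconst]
  -- The sea has energy $-MN^2$; multiplied by $2M$, its subtraction gives exactly the constant
  -- $2(MN)^2$ on the other side.
  have hR : ∑ x ∈ window M N, ((x.2.1 : ℂ) + 1 / 2) • bilin c c' x x =
      ∑ x ∈ window M N, ((x.2.1 : ℂ) + 1 / 2) • (c' x * c x) + ((M : ℂ) * N ^ 2) • (1 : A) := by
    simp only [bilin, smul_sub, Finset.sum_sub_distrib, smul_smul, if_true]
    rw [← Finset.sum_smul, sum_energy_sea]
    module
  rw [hR, smul_add, ← add_assoc, Finset.smul_sum, Finset.smul_sum, ← Finset.sum_add_distrib]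
  congr 1
  · refine Finset.sum_congr rfl fun x _ => ?_
    module
  · module

end Site

/-! ### Bilinears on states which agree with the Dirac vacuum outside a window -/

namespace Site

variable {M : ℕ} {F : Type*} [NormedAddCommGroup F] [InnerProductSpace ℂ F]

/-- The vector `η` looks like the Dirac vacuum outside the window `[-N, N)`. -/
def IsConfined (c c' : Site M → F →L[ℂ] F) (N : ℕ) (η : F) : Prop :=
  ∀ x : Site M, ((N : ℤ) ≤ x.2.1 → c x η = 0) ∧ (x.2.1 < -(N : ℤ) → c' x η = 0)

variable {c c' : Site M → F →L[ℂ] F} {N N' : ℕ} {η ξ : F}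

theorem IsConfined.mono (h : IsConfined c c' N η) (hN : N ≤ N') : IsConfined c c' N' η :=
  fun x => ⟨fun hx => (h x).1 (by omega), fun hx => (h x).2 (by omega)⟩

theorem IsConfined.zero : IsConfined c c' N (0 : F) := fun _ =>
  ⟨fun _ => map_zero _, fun _ => map_zero _⟩

theorem IsConfined.add (h : IsConfined c c' N η) (h' : IsConfined c c' N ξ) :
    IsConfined c c' N (η + ξ) := fun x =>
  ⟨fun hx => by rw [map_add, (h x).1 hx, (h' x).1 hx, add_zero],
    fun hx => by rw [map_add, (h x).2 hx, (h' x).2 hx, add_zero]⟩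

theorem IsConfined.smul (z : ℂ) (h : IsConfined c c' N η) : IsConfined c c' N (z • η) := fun x =>
  ⟨fun hx => by rw [map_smul, (h x).1 hx, smul_zero],
    fun hx => by rw [map_smul, (h x).2 hx, smul_zero]⟩

theorem IsConfined.sum {κ : Type*} {P : Finset κ} {f : κ → F}
    (h : ∀ i ∈ P, IsConfined c c' N (f i)) : IsConfined c c' N (∑ i ∈ P, f i) := by
  classical
  induction P using Finset.induction_on with
  | empty => exact IsConfined.zero
  | insert p P hp ih =>
    rw [Finset.sum_insert hp]
    exact (h p (Finset.mem_insert_self _ _)).add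
      (ih fun i hi => h i (Finset.mem_insert_of_mem hi))

theorem bilin_apply (x y : Site M) (η : F) :
    bilin c c' x y η = c' x (c y η) - (if x = y then sea x else 0) • η := rfl

/-- Above the window `c y` kills the vector. Below it, anticommuting lets `c' x` act first, and the
contraction at `x = y` is cancelled by the sea subtraction. -/
theorem IsConfined.bilin_eq_zero (hc : IsCAR c c') (h : IsConfined c c' N η) {x y : Site M}
    (hxy : x.2.1 < -(N : ℤ) ∨ (N : ℤ) ≤ y.2.1) : bilin c c' x y η = 0 := by
  rw [bilin_apply]
  rcases hxy with hx | hy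
  · have h1 := DFunLike.congr_fun (hc.ann_cre y x) η
    change c y (c' x η) = (if y = x then (1 : F →L[ℂ] F) else 0) η - c' x (c y η) at h1
    rw [(h x).2 hx, map_zero] at h1
    rw [← sub_eq_zero.1 h1.symm]
    by_cases hxy : x = y
    · subst hxy
      rw [if_pos rfl, if_pos rfl, sea, if_pos (by omega)]
      simp
    · rw [if_neg hxy, if_neg (Ne.symm hxy)]
      simp
  · rw [(h y).1 hy, map_zero, zero_sub, neg_eq_zero]
    by_cases hxy : x = y
    · subst hxy
      rw [if_pos rfl, sea, if_neg (by omega), zero_smul]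
    · rw [if_neg hxy, zero_smul]

/-- The bound on `y` keeps it distinct from the sites below the window, so `c y` anticommutes with
their creators. -/
theorem IsConfined.ann (hc : IsCAR c c') (h : IsConfined c c' N η) {y : Site M}
    (hy : -(N : ℤ) ≤ y.2.1) : IsConfined c c' N (c y η) := by
  refine fun x => ⟨fun hx => ?_, fun hx => ?_⟩
  · have h1 := DFunLike.congr_fun (hc.ann_ann x y) η
    change c x (c y η) = -(c y (c x η)) at h1
    rw [h1, (h x).1 hx, map_zero, neg_zero]
  · have h1 := DFunLike.congr_fun (hc.ann_cre y x) η
    rw [if_neg (by rintro rfl; omega)] at h1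
    change c y (c' x η) = 0 - c' x (c y η) at h1
    rw [(h x).2 hx, map_zero, zero_sub] at h1
    exact neg_eq_zero.1 h1.symm

theorem IsConfined.cre (hc : IsCAR c c') (h : IsConfined c c' N η) {y : Site M}
    (hy : y.2.1 < N) : IsConfined c c' N (c' y η) := by
  refine fun x => ⟨fun hx => ?_, fun hx => ?_⟩
  · have h1 := DFunLike.congr_fun (hc.ann_cre x y) η
    rw [if_neg (by rintro rfl; omega)] at h1
    change c x (c' y η) = 0 - c' y (c x η) at h1
    rw [h1, (h x).1 hx, map_zero, sub_zero]
  · have h1 := DFunLike.congr_fun (hc.cre_cre x y) η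
    change c' x (c' y η) = -(c' y (c' x η)) at h1
    rw [h1, (h x).2 hx, map_zero, neg_zero]

variable [NeZero M]

theorem nquad_apply (B : Site M → Site M → ℂ) (η : F) :
    nquad N c c' B η = ∑ x ∈ window M N, ∑ y ∈ window M N, B x y • bilin c c' x y η := by
  unfold nquad
  simp only [sum_apply, smul_apply]

theorem IsConfined.nquad (hc : IsCAR c c') (h : IsConfined c c' N η) (B : Site M → Site M → ℂ) :
    IsConfined c c' N (nquad N c c' B η) := by
  rw [nquad_apply]
  refine IsConfined.sum fun x hx => IsConfined.sum fun y hy => IsConfined.smul _ ?_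
  rw [mem_window] at hx hy
  rw [bilin_apply, sub_eq_add_neg, ← neg_smul]
  exact ((h.ann hc hy.1).cre hc hx.2).add (h.smul _)

/-- A transfer of at least the width of the window forces `x` below it or `y` above it. -/
theorem IsConfined.nquad_hop_eq_zero (hc : IsCAR c c') (h : IsConfined c c' N η)
    (U : ℤˣ → ℤˣ → ℂ) {q : ℤ} (hq : 2 * (N : ℤ) ≤ q) (t : ZMod M) (N' : ℕ) :
    Site.nquad N' c c' (hop U q t) η = 0 := by
  rw [nquad_apply]
  refine Finset.sum_eq_zero fun x _ => Finset.sum_eq_zero fun y _ => ?_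
  unfold hop
  split_ifs with hxy
  · rw [h.bilin_eq_zero hc (by omega), smul_zero]
  · rw [zero_smul]

theorem IsConfined.sum_bilin_self (hc : IsCAR c c') (h : IsConfined c c' N η) (hN : N ≤ N')
    (f : Site M → ℂ) :
    HasSum (fun x => f x • bilin c c' x x η) (∑ x ∈ window M N', f x • bilin c c' x x η) := by
  refine hasSum_sum_of_ne_finset_zero fun x hx => ?_
  rw [mem_window] at hx
  rw [h.bilin_eq_zero hc (by omega), smul_zero]

/-- Only finitely many terms survive: `-N ≤ x`, `y < N` and `y = x + q` longitudinally put both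
sites in the larger window, and their transverse coordinates determine the umklapp index. -/
theorem IsConfined.hasSum_hop (hc : IsCAR c c') (h : IsConfined c c' N η)
    (U : ℤˣ → ℤˣ → ℂ) {rep : ZMod M → ℤ} (hrep : ∀ z, (rep z : ZMod M) = z) (q t : ℤ)
    (hN : N + |q| ≤ (N' : ℤ)) :
    HasSum (fun i : (Site M × Site M) × ℤ =>
        if i.1.2.2.1 = i.1.1.2.1 + q ∧ rep i.1.1.2.2 + t = rep i.1.2.2.2 + i.2 * M then
          U i.1.1.1 i.1.2.1 • bilin c c' i.1.1 i.1.2 η else 0)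
      (Site.nquad N' c c' (hop U q t) η) := by
  have hM : (M : ℤ) ≠ 0 := by exact_mod_cast NeZero.ne M
  have h1 := neg_abs_le q
  have h2 := le_abs_self q
  -- The division is exact whenever the selection rule can hold; elsewhere the value is irrelevant.
  set n : Site M × Site M → ℤ := fun i => (rep i.1.2.2 + t - rep i.2.2.2) / M with hn
  have hn' : ∀ (x y : Site M) (m : ℤ), rep x.2.2 + t = rep y.2.2 + m * M → m = n (x, y) := by
    intro x y m hm
    have : rep x.2.2 + t - rep y.2.2 = m * M := by omega
    rw [hn]
    simp only [this]
    rw [Int.mul_ediv_cancel _ hM]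
  set g : Site M × Site M → (Site M × Site M) × ℤ := fun i => (i, n i) with hg
  have hgi : Function.Injective g := fun i j hij => congrArg Prod.fst hij
  have key := hasSum_sum_of_ne_finset_zero (L := SummationFilter.unconditional _)
    (s := (window M N' ×ˢ window M N').map ⟨g, hgi⟩)
    (f := fun i : (Site M × Site M) × ℤ =>
        if i.1.2.2.1 = i.1.1.2.1 + q ∧ rep i.1.1.2.2 + t = rep i.1.2.2.2 + i.2 * M then
          U i.1.1.1 i.1.2.1 • bilin c c' i.1.1 i.1.2 η else 0) ?_
  · convert key using 1
    rw [Finset.sum_map, Finset.sum_product, nquad_apply]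
    refine Finset.sum_congr rfl fun x _ => Finset.sum_congr rfl fun y _ => ?_
    change _ = if y.2.1 = x.2.1 + q ∧ rep x.2.2 + t = rep y.2.2 + n (x, y) * M then
      U x.1 y.1 • bilin c c' x y η else 0
    unfold hop
    have hiff : y.2.2 = x.2.2 + (t : ZMod M) ↔ rep x.2.2 + t = rep y.2.2 + n (x, y) * M := by
      constructor
      · intro hy
        have h3 : ((rep x.2.2 + t - rep y.2.2 : ℤ) : ZMod M) = 0 := by
          push_cast
          rw [hrep, hrep, hy, sub_self]
        obtain ⟨m, hm⟩ := (ZMod.intCast_zmod_eq_zero_iff_dvd _ M).1 h3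
        have h4 : rep x.2.2 + t = rep y.2.2 + m * M := by linarith [mul_comm m (M : ℤ)]
        rw [← hn' x y m h4, h4]
      · intro hy
        have h3 := congrArg (Int.cast : ℤ → ZMod M) hy
        push_cast at h3
        rw [hrep, hrep] at h3
        simpa using h3.symm
    simp only [hiff, ite_smul, zero_smul]
  · rintro ⟨⟨x, y⟩, m⟩ hi
    simp only
    split_ifs with hxy
    · obtain rfl := hn' x y m hxy.2
      have : ¬(x ∈ window M N' ∧ y ∈ window M N') := fun hm => by
        refine hi (Finset.mem_map.2 ⟨(x, y), Finset.mem_product.2 hm, rfl⟩)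
      rw [mem_window, mem_window] at this
      rw [h.bilin_eq_zero hc (by omega), smul_zero]
    · rfl

end Site

/-! ### Integer coordinates on the momentum lattices -/

namespace Nodal

theorem sgn_mul_self (r : ℤˣ) : sgn r * sgn r = 1 := by
  rcases Int.units_eq_one_or r with rfl | rfl <;> simp [sgn]

theorem units_eq_or_neg (u s : ℤˣ) : u = s ∨ u = -s := by
  revert u s
  decide

theorem neg_ne_units (s : ℤˣ) : -s ≠ s := by
  revert s
  decide

/-- The momentum with longitudinal coordinate `l` and transverse coordinate `t`, on the lattice
shifted by `o`. -/
noncomputable def latticePoint (L : ℝ) (r s : ℤˣ) (o : ℝ) (l t : ℤ) : Momentum := fun u =>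
  if u = s then sgn r * (2 * Real.pi / L * (l + o)) else 2 * Real.pi / L * (t + o)

theorem latticePoint_self (L : ℝ) (r s : ℤˣ) (o : ℝ) (l t : ℤ) :
    latticePoint L r s o l t s = sgn r * (2 * Real.pi / L * (l + o)) := if_pos rfl

theorem latticePoint_neg (L : ℝ) (r s : ℤˣ) (o : ℝ) (l t : ℤ) :
    latticePoint L r s o l t (-s) = 2 * Real.pi / L * (t + o) := if_neg (neg_ne_units s)

/-- Momenta on the lattice shifted by `o`, with transverse component in `[-π/a, π/a)`. -/
def latticeMomenta (L a : ℝ) (s : ℤˣ) (o : ℝ) : Set Momentum :=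
  {k | (∀ t, ∃ m : ℤ, k t = 2 * Real.pi / L * (m + o)) ∧
    -(Real.pi / a) ≤ k (-s) ∧ k (-s) < Real.pi / a}

theorem bosonMomenta_eq (L a : ℝ) (s : ℤˣ) : bosonMomenta L a s = latticeMomenta L a s 0 := by
  simp only [bosonMomenta, latticeMomenta, add_zero]

variable {L a : ℝ} {M : ℕ}

theorem transverse_mem_iff (hL : 0 < L) (ha : 0 < a) (hM : L = M * a) (y : ℝ) :
    (-(Real.pi / a) ≤ 2 * Real.pi / L * y ∧ 2 * Real.pi / L * y < Real.pi / a) ↔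
      y ∈ Set.Ico (-(M / 2 : ℝ)) (-(M / 2) + M) := by
  have hM0 : (M : ℝ) ≠ 0 := by
    rintro h
    rw [h, zero_mul] at hM
    exact hL.ne' hM
  have h1 : Real.pi / a = 2 * Real.pi / L * (M / 2) := by
    rw [hM]
    field_simp
  have h2 : 0 < 2 * Real.pi / L := by positivity
  rw [h1, ← mul_neg, mul_le_mul_iff_right₀ h2, mul_lt_mul_iff_right₀ h2, Set.mem_Ico]
  constructor
  · rintro ⟨h3, h4⟩
    exact ⟨h3, by linarith⟩
  · rintro ⟨h3, h4⟩
    exact ⟨h3, by linarith⟩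

/-- Every residue modulo `M` has a unique representative in a given half-open interval. -/
theorem exists_representative [NeZero M] (o b : ℝ) :
    ∃ rep : ZMod M → ℤ, (∀ z, (rep z : ZMod M) = z) ∧
      (∀ z, (rep z : ℝ) + o ∈ Set.Ico b (b + M)) ∧
      ∀ t : ℤ, (t : ℝ) + o ∈ Set.Ico b (b + M) → rep t = t := by
  have hM : (0 : ℝ) < M := by exact_mod_cast Nat.pos_of_ne_zero (NeZero.ne M)
  choose n hn _ using fun z : ZMod M => existsUnique_add_zsmul_mem_Ico hM ((z.val : ℝ) + o) b
  have hmem : ∀ z : ZMod M, (((z.val : ℤ) + n z * M : ℤ) : ℝ) + o ∈ Set.Ico b (b + M) := by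
    intro z
    have : (z.val : ℝ) + o + n z • (M : ℝ) ∈ Set.Ico b (b + M) := hn z
    rw [zsmul_eq_mul] at this
    convert this using 1
    push_cast
    ring
  have hcast : ∀ z : ZMod M, ((((z.val : ℤ) + n z * M : ℤ)) : ZMod M) = z := by
    intro z
    push_cast
    rw [ZMod.natCast_self, mul_zero, add_zero, ZMod.natCast_zmod_val]
  refine ⟨fun z => (z.val : ℤ) + n z * M, hcast, hmem, fun t ht => ?_⟩
  have h1 := hmem (t : ZMod M)
  have h2 := hcast (t : ZMod M)
  simp only
  set u : ℤ := ((t : ZMod M).val : ℤ) + n t * M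
  have h3 : ((u - t : ℤ) : ZMod M) = 0 := by rw [Int.cast_sub, h2, sub_self]
  rw [ZMod.intCast_zmod_eq_zero_iff_dvd] at h3
  have h4 : |u - t| < (M : ℤ) := by
    have h5 : |((u : ℝ) - t)| < M := abs_lt.2 ⟨by linarith [h1.1, ht.2], by linarith [h1.2, ht.1]⟩
    exact_mod_cast h5
  have := Int.eq_zero_of_abs_lt_dvd h3 h4
  omega

/-- The sign of `r` is built into the longitudinal coordinate so that $rk_s$ increases with it.
Since `2 * o` is an integer, the shifted lattice is invariant under sign reversal. Fermions use `o =
1 / 2`, bosons `o = 0`. -/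
theorem exists_chart [NeZero M] (hL : 0 < L) (ha : 0 < a) (hM : L = M * a) (r s : ℤˣ) {o : ℝ}
    (ho : ∃ j : ℤ, 2 * o = j) :
    ∃ (e : ℤ × ZMod M ≃ latticeMomenta L a s o) (rep : ZMod M → ℤ),
      (∀ z, (rep z : ZMod M) = z) ∧ ∀ i, (e i).1 = latticePoint L r s o i.1 (rep i.2) := by
  obtain ⟨j, hj⟩ := ho
  obtain ⟨rep, hrep, hmem, huniq⟩ := exists_representative (M := M) o (-(M / 2 : ℝ))
  have hp : 2 * Real.pi / L ≠ 0 := by positivity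
  have hr := sgn_mul_self r
  have hsgn : ∀ m : ℤ, ∃ l : ℤ, (m : ℝ) + o = sgn r * (l + o) := by
    intro m
    rcases Int.units_eq_one_or r with rfl | rfl
    · exact ⟨m, by simp [sgn]⟩
    · refine ⟨-m - j, ?_⟩
      simp [sgn, ← hj]
      ring
  have hsgn' : ∀ l : ℤ, ∃ m : ℤ, sgn r * (l + o) = (m : ℝ) + o := by
    intro l
    obtain ⟨m, hm⟩ := hsgn l
    exact ⟨m, by rw [hm, ← mul_assoc, hr, one_mul]⟩
  let f : ℤ × ZMod M → latticeMomenta L a s o := fun i =>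
    ⟨latticePoint L r s o i.1 (rep i.2), by
      refine ⟨fun u => ?_, ?_⟩
      · rcases units_eq_or_neg u s with rfl | rfl
        · obtain ⟨m, hm⟩ := hsgn' i.1
          refine ⟨m, ?_⟩
          rw [latticePoint_self, ← hm]
          ring
        · exact ⟨rep i.2, latticePoint_neg ..⟩
      · rw [latticePoint_neg]
        exact (transverse_mem_iff hL ha hM _).2 (hmem i.2)⟩
  have hf : Function.Bijective f := by
    constructor
    · rintro ⟨l, z⟩ ⟨l', z'⟩ h
      have h1 : latticePoint L r s o l (rep z) = latticePoint L r s o l' (rep z') :=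
        congrArg Subtype.val h
      have h2 := congrFun h1 s
      have h3 := congrFun h1 (-s)
      rw [latticePoint_self, latticePoint_self] at h2
      rw [latticePoint_neg, latticePoint_neg] at h3
      have h4 := congrArg (fun y => sgn r * y) h2
      simp only [← mul_assoc, hr, one_mul] at h4
      have h5 : (l : ℝ) = l' := by linarith [mul_left_cancel₀ hp h4]
      have h6 : (rep z : ℝ) = rep z' := by linarith [mul_left_cancel₀ hp h3]
      have h7 : rep z = rep z' := by exact_mod_cast h6
      refine Prod.ext (by exact_mod_cast h5) ?_
      rw [← hrep z, h7, hrep]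
    · rintro ⟨k, hk, hk'⟩
      obtain ⟨m, hm⟩ := hk s
      obtain ⟨t, ht⟩ := hk (-s)
      obtain ⟨l, hl⟩ := hsgn m
      rw [ht] at hk'
      have h1 := huniq t ((transverse_mem_iff hL ha hM _).1 hk')
      refine ⟨(l, (t : ZMod M)), Subtype.ext (funext fun u => ?_)⟩
      change latticePoint L r s o l (rep t) u = k u
      rcases units_eq_or_neg u s with rfl | rfl
      · rw [latticePoint_self, hm, hl]
        ring
      · rw [latticePoint_neg, ht, h1]
  exact ⟨Equiv.ofBijective f hf, rep, hrep, fun i => rfl⟩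

/-- The momentum selection rule of the nodal bilinears in integer coordinates. -/
theorem latticePoint_add_eq_iff (hL : 0 < L) (ha : 0 < a) (hM : L = M * a) (r s : ℤˣ)
    (o : ℝ) (l t l' t' q u n : ℤ) :
    latticePoint L r s o l t + latticePoint L r s 0 q u =
        latticePoint L r s o l' t' + Pi.single (-s) (2 * Real.pi * n / a) ↔
      l' = l + q ∧ t + u = t' + n * M := by
  have hp : 2 * Real.pi / L ≠ 0 := by positivity
  have hr := sgn_mul_self r
  have hM0 : (M : ℝ) ≠ 0 := by
    rintro h
    rw [h, zero_mul] at hM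
    exact hL.ne' hM
  have h1 : 2 * Real.pi * n / a = 2 * Real.pi / L * (n * M) := by
    rw [hM]
    field_simp
  rw [h1]
  constructor
  · intro h
    have h2 := congrFun h s
    have h3 := congrFun h (-s)
    rw [Pi.add_apply, Pi.add_apply, latticePoint_self, latticePoint_self, latticePoint_self,
      Pi.single_eq_of_ne (neg_ne_units s).symm] at h2
    rw [Pi.add_apply, Pi.add_apply, latticePoint_neg, latticePoint_neg, latticePoint_neg,
      Pi.single_eq_same, ← mul_add, ← mul_add] at h3
    have h4 := congrArg (fun y => sgn r * y) h2
    simp only [mul_add, ← mul_assoc, hr, one_mul, add_zero] at h4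
    have h5 := mul_left_cancel₀ hp h3
    have h6 : (l : ℝ) + q = l' := by
      refine mul_left_cancel₀ hp ?_
      linarith
    have h7 : (t : ℝ) + u = t' + n * M := by linarith
    exact ⟨by exact_mod_cast h6.symm, by exact_mod_cast h7⟩
  · rintro ⟨rfl, h⟩
    have h7 : (t : ℝ) + u = t' + n * M := by exact_mod_cast h
    funext v
    rcases units_eq_or_neg v s with rfl | rfl
    · rw [Pi.add_apply, Pi.add_apply, latticePoint_self, latticePoint_self, latticePoint_self,
        Pi.single_eq_of_ne (neg_ne_units v).symm]
      push_cast
      ring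
    · rw [Pi.add_apply, Pi.add_apply, latticePoint_neg, latticePoint_neg, latticePoint_neg,
        Pi.single_eq_same, ← mul_add, ← mul_add]
      congr 1
      linarith

theorem neg_latticePoint (L : ℝ) (r s : ℤˣ) (q t : ℤ) :
    -latticePoint L r s 0 q t = latticePoint L r s 0 (-q) (-t) := by
  funext u
  rw [Pi.neg_apply]
  unfold latticePoint
  push_cast
  split_ifs <;> ring

theorem sgn_mul_latticePoint_neg_iff (hL : 0 < L) (r s : ℤˣ) (q t : ℤ) :
    sgn r * latticePoint L r s 0 q t s < 0 ↔ q < 0 := by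
  have hp : 0 < 2 * Real.pi / L := by positivity
  rw [latticePoint_self, ← mul_assoc, sgn_mul_self, one_mul, add_zero, mul_neg_iff]
  constructor
  · rintro (h | h)
    · exact_mod_cast h.2
    · exact absurd h.1 hp.not_gt
  · intro h
    exact Or.inl ⟨hp, by exact_mod_cast h⟩

end Nodal

/-! ### Nodal fermions in integer coordinates -/

namespace Nodal

open FermionFock Site

/-- Integer coordinates of the fermion momenta. -/
structure Chart (L a : ℝ) (r s : ℤˣ) (M : ℕ) where
  e : ℤ × ZMod M ≃ fermiMomenta L a s
  rep : ZMod M → ℤ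
  cast_rep : ∀ z, (rep z : ZMod M) = z
  val : ∀ i, (e i).1 = latticePoint L r s (1 / 2) i.1 (rep i.2)

variable {L a : ℝ} {M : ℕ} {r s : ℤˣ}

theorem Chart.nonempty [NeZero M] (hL : 0 < L) (ha : 0 < a) (hM : L = M * a) (r s : ℤˣ) :
    Nonempty (Chart L a r s M) := by
  obtain ⟨e, rep, h1, h2⟩ := exists_chart hL ha hM r s (o := 1 / 2) ⟨1, by norm_num⟩
  exact ⟨⟨e, rep, h1, h2⟩⟩

namespace Chart

variable (C : Chart L a r s M)

/-- The mode with given spin and momentum coordinates. -/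
def mode (x : Site M) : Mode L a := ⟨r, s, x.1, C.e x.2⟩

theorem mode_injective : Function.Injective C.mode := by
  rintro ⟨α, i⟩ ⟨β, j⟩ h
  simp only [mode, Mode.mk.injEq, true_and, heq_eq_eq] at h
  exact Prod.ext h.1 (C.e.injective h.2)

/-- The energy of a mode. -/
theorem energy (x : Site M) : sgn r * (C.e x.2).1 s = 2 * Real.pi / L * (x.2.1 + 1 / 2) := by
  rw [C.val, latticePoint_self, ← mul_assoc, sgn_mul_self, one_mul]

theorem energy_pos_iff (hL : 0 < L) (x : Site M) : 0 < sgn r * (C.e x.2).1 s ↔ 0 ≤ x.2.1 := by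
  have hp : 0 < 2 * Real.pi / L := by positivity
  rw [C.energy, mul_pos_iff_of_pos_left hp]
  constructor
  · intro h
    have : (-1 : ℝ) < x.2.1 := by linarith
    have : (-1 : ℤ) < x.2.1 := by exact_mod_cast this
    omega
  · intro h
    have : (0 : ℝ) ≤ x.2.1 := by exact_mod_cast h
    linarith

/-- The nodal fermion operator, normalised by `{c, c†} = 1`. -/
noncomputable def ladder (x : Site M) : Fock L a →L[ℂ] Fock L a :=
  if 0 ≤ x.2.1 then ann (C.mode x) else star (ann (C.mode x))

/-- The adjoint of the nodal fermion operator, normalised by `{c, c†} = 1`. -/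
noncomputable def ladderDag (x : Site M) : Fock L a →L[ℂ] Fock L a := star (C.ladder x)

theorem psi_eq (hL : 0 < L) (x : Site M) :
    psi r s x.1 (C.e x.2) = ((L / (2 * Real.pi) : ℝ) : ℂ) • C.ladder x := by
  unfold psi ladder
  congr 1
  exact if_congr (C.energy_pos_iff hL x) rfl rfl

theorem psiDag_eq (hL : 0 < L) (x : Site M) :
    psiDag r s x.1 (C.e x.2) = ((L / (2 * Real.pi) : ℝ) : ℂ) • C.ladderDag x := by
  unfold psiDag ladderDag
  rw [← ContinuousLinearMap.star_eq_adjoint, C.psi_eq hL, star_smul]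
  congr 1
  exact Complex.conj_ofReal _

/-- Exchanging annihilators and creators on the sea modes preserves the relations. -/
theorem isCAR : IsCAR C.ladder C.ladderDag := by
  have haa : ∀ q q' : Mode L a, ann q * ann q' = -(ann q' * ann q) := fun q q' =>
    eq_neg_of_add_eq_zero_left (ann_mul_ann q q')
  have hss : ∀ q q' : Mode L a, star (ann q) * star (ann q') = -(star (ann q') * star (ann q)) :=
    fun q q' => by rw [← star_mul, ← star_mul, haa q q', star_neg, neg_neg]
  have has : ∀ x y : Site M, ann (C.mode x) * star (ann (C.mode y)) =
      (if x = y then 1 else 0) - star (ann (C.mode y)) * ann (C.mode x) := fun x y => by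
    rw [eq_sub_iff_add_eq, ann_mul_adjoint_ann]
    exact if_congr C.mode_injective.eq_iff rfl rfl
  have h1 : ∀ x y, C.ladder x * C.ladder y = -(C.ladder y * C.ladder x) := by
    intro x y
    unfold ladder
    split_ifs with hx hy hy
    · exact haa _ _
    · rw [has x y, if_neg (by rintro rfl; exact hy hx), zero_sub]
    · rw [has y x, if_neg (by rintro rfl; exact hx hy), zero_sub, neg_neg]
    · exact hss _ _
  refine ⟨h1, fun x y => ?_, fun x y => ?_⟩
  · unfold ladderDag
    rw [← star_mul, ← star_mul, h1 x y, star_neg, neg_neg]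
  · unfold ladderDag ladder
    split_ifs with hx hy hxy hxy hy hxy hxy
    · rw [has, if_pos hxy]
    · rw [has, if_neg hxy]
    · subst hxy; exact absurd hx hy
    · rw [star_star, haa, zero_sub]
    · subst hxy; exact absurd hy hx
    · rw [hss, zero_sub]
    · subst hxy
      rw [star_star, has, if_pos rfl, sub_sub_cancel]
    · rw [star_star, has, if_neg (Ne.symm hxy)]
      noncomm_ring

theorem ladder_vacuum (x : Site M) :
    C.ladder x (Ω L a) = if 0 ≤ x.2.1 then 0 else basisVec {C.mode x} := by
  unfold ladder Ω vacuum
  split_ifs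
  · rw [ann_basisVec, if_neg (Finset.notMem_empty _)]
  · rw [adjoint_ann_basisVec, if_neg (Finset.notMem_empty _)]
    simp [jwSign]

theorem vacuum_expectation (x y : Site M) :
    ⟪Ω L a, (C.ladderDag x * C.ladder y) (Ω L a)⟫_ℂ = if x = y then sea x else 0 := by
  change ⟪Ω L a, C.ladderDag x (C.ladder y (Ω L a))⟫_ℂ = _
  rw [ladderDag, ContinuousLinearMap.star_eq_adjoint, ContinuousLinearMap.adjoint_inner_right,
    C.ladder_vacuum, C.ladder_vacuum]
  unfold sea
  split_ifs with hx hy hxy hlt hxy hlt hy hxy hlt hxy hlt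
  all_goals first
    | omega
    | simp only [inner_zero_left, inner_zero_right]
    | skip
  · subst hxy; exact absurd hy hx
  · rw [inner_basisVec_left, hxy, basisVec_apply, if_pos rfl]
  · rw [inner_basisVec_left, basisVec_apply, if_neg]
    rw [Finset.singleton_inj]
    exact fun h => hxy (C.mode_injective h)

theorem fermionOrder_eq (x y : Site M) :
    fermionOrder (C.ladderDag x * C.ladder y) = bilin C.ladder C.ladderDag x y := by
  unfold fermionOrder bilin
  rw [C.vacuum_expectation]
  rfl

theorem fermionOrder_smul (z : ℂ) (O : Fock L a →L[ℂ] Fock L a) :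
    fermionOrder (z • O) = z • fermionOrder O := by
  unfold fermionOrder
  rw [smul_apply, inner_smul_right, smul_sub, smul_smul]

theorem normalOrdered_eq (hL : 0 < L) (x y : Site M) (z : ℂ) :
    (((2 * Real.pi / L) ^ 2 : ℝ) : ℂ) •
        fermionOrder (psiDag r s x.1 (C.e x.2) * (z • psi r s y.1 (C.e y.2))) =
      z • bilin C.ladder C.ladderDag x y := by
  rw [C.psi_eq hL, C.psiDag_eq hL, mul_smul_comm, smul_mul_smul_comm, smul_smul,
    fermionOrder_smul, C.fermionOrder_eq, smul_smul]
  congr 1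
  have hpi := Real.pi_pos.ne'
  have : (2 * Real.pi / L) ^ 2 * ((L / (2 * Real.pi)) * (L / (2 * Real.pi))) = 1 := by
    field_simp
  calc _ = z * (((2 * Real.pi / L) ^ 2 * ((L / (2 * Real.pi)) * (L / (2 * Real.pi))) : ℝ) : ℂ) := by
        push_cast
        ring
    _ = z := by rw [this]; simp

theorem star_bilin (x y : Site M) :
    star (bilin C.ladder C.ladderDag x y) = bilin C.ladder C.ladderDag y x := by
  unfold bilin ladderDag
  rw [star_sub, star_mul, star_star, star_smul, star_one]
  congr 2
  by_cases h : x = y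
  · subst h
    rw [if_pos rfl]
    unfold sea
    split_ifs <;> simp
  · rw [if_neg h, if_neg (Ne.symm h), star_zero]

theorem bilin_mem_finiteVectors (x y : Site M) {η : Fock L a}
    (hη : η ∈ finiteVectors (Mode L a)) :
    bilin C.ladder C.ladderDag x y η ∈ finiteVectors (Mode L a) := by
  have h1 : ∀ (x : Site M) {η : Fock L a}, η ∈ finiteVectors (Mode L a) →
      C.ladder x η ∈ finiteVectors (Mode L a) := by
    intro x η hη
    unfold ladder
    split_ifs
    · exact ann_mem_finiteVectors _ hη
    · exact adjoint_ann_mem_finiteVectors _ hη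
  have h2 : ∀ (x : Site M) {η : Fock L a}, η ∈ finiteVectors (Mode L a) →
      C.ladderDag x η ∈ finiteVectors (Mode L a) := by
    intro x η hη
    unfold ladderDag ladder
    split_ifs
    · exact adjoint_ann_mem_finiteVectors _ hη
    · rw [star_star]
      exact ann_mem_finiteVectors _ hη
  rw [bilin_apply]
  exact Submodule.sub_mem _ (h2 x (h1 y hη)) (Submodule.smul_mem _ _ hη)

theorem nquad_mem_finiteVectors [NeZero M] (N : ℕ) (B : Site M → Site M → ℂ) {η : Fock L a}
    (hη : η ∈ finiteVectors (Mode L a)) :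
    nquad N C.ladder C.ladderDag B η ∈ finiteVectors (Mode L a) := by
  rw [nquad_apply]
  exact Submodule.sum_mem _ fun x _ => Submodule.sum_mem _ fun y _ =>
    Submodule.smul_mem _ _ (C.bilin_mem_finiteVectors x y hη)

theorem exists_isConfined {η : Fock L a} (hη : η ∈ finiteVectors (Mode L a)) :
    ∃ N, IsConfined C.ladder C.ladderDag N η := by
  induction hη using Submodule.span_induction with
  | mem η hη =>
    obtain ⟨S, rfl⟩ := hη
    have hfin : {x : Site M | C.mode x ∈ S}.Finite :=
      Set.Finite.preimage C.mode_injective.injOn S.finite_toSet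
    obtain ⟨N, hN⟩ := (hfin.image fun x => x.2.1.natAbs).bddAbove
    have hS : ∀ x : Site M, (N : ℤ) < |x.2.1| → C.mode x ∉ S := by
      intro x hx hmem
      have : x.2.1.natAbs ≤ N := hN ⟨x, hmem, rfl⟩
      rw [Int.abs_eq_natAbs] at hx
      omega
    -- `N` bounds the coordinates of occupied modes inclusively, whereas windows are half-open.
    refine ⟨N + 1, fun x => ⟨fun hx => ?_, fun hx => ?_⟩⟩
    · unfold ladder
      rw [if_pos (by omega), ann_basisVec, if_neg (hS x ?_)]
      have := le_abs_self x.2.1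
      omega
    · unfold ladderDag ladder
      rw [if_neg (by omega), star_star, ann_basisVec, if_neg (hS x ?_)]
      have := neg_le_abs x.2.1
      omega
  | zero => exact ⟨0, IsConfined.zero⟩
  | add η ξ _ _ h1 h2 =>
    obtain ⟨N, hN⟩ := h1
    obtain ⟨N', hN'⟩ := h2
    exact ⟨max N N', (hN.mono (le_max_left _ _)).add (hN'.mono (le_max_right _ _))⟩
  | smul z η _ h =>
    obtain ⟨N, hN⟩ := h
    exact ⟨N, hN.smul z⟩

/-- The sign is negative on holes, where `l + 1 / 2` is negative too; hence every excitation has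
positive energy. -/
theorem bilin_self_apply (x : Site M) (η : Fock L a) (S : Finset (Mode L a)) :
    (bilin C.ladder C.ladderDag x x η) S =
      (if 0 ≤ x.2.1 then 1 else -1) * if C.mode x ∈ S then η S else 0 := by
  have hn : (star (ann (C.mode x)) (ann (C.mode x) η)) S = if C.mode x ∈ S then η S else 0 := by
    rw [adjoint_ann_apply, ann_apply]
    split_ifs with h1 h2
    · exact absurd h2 (Finset.notMem_erase _ _)
    · rw [jwSign_erase_self, Finset.insert_erase h1, ← mul_assoc, jwSign_mul_self, one_mul]
    · rfl
  rw [bilin_apply, if_pos rfl]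
  unfold ladderDag ladder sea
  by_cases hx : 0 ≤ x.2.1
  · rw [if_pos hx, if_pos hx, if_neg (by omega), zero_smul, sub_zero, hn, one_mul]
  · rw [if_neg hx, if_neg hx, if_pos (by omega), one_smul, star_star, lp.coeFn_sub, Pi.sub_apply]
    have h1 := DFunLike.congr_fun (ann_mul_adjoint_ann (C.mode x) (C.mode x)) η
    rw [if_pos rfl] at h1
    change ann (C.mode x) (star (ann (C.mode x)) η) + star (ann (C.mode x)) (ann (C.mode x) η) = η
      at h1
    have h2 := congrArg (fun f : Fock L a => f S) h1
    simp only [lp.coeFn_add, Pi.add_apply, hn] at h2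
    linear_combination h2

end Chart

end Nodal

/-! ### Formal adjoints relative to a space of test vectors. -/

namespace UnboundedOp

variable {F : Type*} [NormedAddCommGroup F] [InnerProductSpace ℂ F]

theorem hasSum_inner_left {ι : Type*} {f : ι → F} {ξ : F} (h : HasSum f ξ) (φ : F) :
    HasSum (fun i => ⟪f i, φ⟫_ℂ) ⟪ξ, φ⟫_ℂ := by
  have h1 := (h.mapL (innerSL ℂ φ)).star
  simpa [inner_conj_symm] using h1

theorem hasSum_inner_right {ι : Type*} {f : ι → F} {ξ : F} (h : HasSum f ξ) (φ : F) :
    HasSum (fun i => ⟪φ, f i⟫_ℂ) ⟪φ, ξ⟫_ℂ := by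
  simpa using h.mapL (innerSL ℂ φ)

/-- On the test space `D`, the operator `T'` is a formal adjoint of `T`. -/
def Adj (D : Submodule ℂ F) (T T' : F →ₗ.[ℂ] F) : Prop :=
  ∀ η ξ φ ζ, Maps T η ξ → φ ∈ D → Maps T' φ ζ → ⟪ξ, φ⟫_ℂ = ⟪η, ζ⟫_ℂ

variable {D : Submodule ℂ F} {S S' T T' : F →ₗ.[ℂ] F}

theorem Adj.smul {c : ℂ} (hc : starRingEnd ℂ c = c) (h : Adj D T T') : Adj D (c • T) (c • T') := by
  intro η ξ φ ζ h1 hφ h2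
  obtain ⟨ξ, h3, rfl⟩ := maps_smul.1 h1
  obtain ⟨ζ, h4, rfl⟩ := maps_smul.1 h2
  rw [inner_smul_left, inner_smul_right, hc, h _ _ _ _ h3 hφ h4]

theorem Adj.add (h : Adj D S S') (h' : Adj D T T') : Adj D (S + T) (S' + T') := by
  intro η ξ φ ζ h1 hφ h2
  obtain ⟨ξ, ξ', h3, h3', rfl⟩ := maps_add.1 h1
  obtain ⟨ζ, ζ', h4, h4', rfl⟩ := maps_add.1 h2
  rw [inner_add_left, inner_add_right, h _ _ _ _ h3 hφ h4, h' _ _ _ _ h3' hφ h4']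

theorem Adj.sum {ι : Type*} {T T' : ι → (F →ₗ.[ℂ] F)} (h : ∀ i, Adj D (T i) (T' i)) :
    Adj D (UnboundedOp.sum T) (UnboundedOp.sum T') := by
  intro η ξ φ ζ h1 hφ h2
  obtain ⟨f, hf, hs⟩ := maps_sum.1 h1
  obtain ⟨g, hg, hs'⟩ := maps_sum.1 h2
  refine (hasSum_inner_left hs φ).unique ?_
  simp only [fun i => h i _ _ _ _ (hf i) hφ (hg i)]
  exact hasSum_inner_right hs' η

/-- `η` ranges over the whole natural domain but `φ` only over `D`, so the second transposition
needs `S'` to map test vectors to test vectors. -/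
theorem Adj.mul (hS : Adj D S S') (hT : Adj D T T') (hD : ∀ φ ζ, φ ∈ D → Maps S' φ ζ → ζ ∈ D) :
    Adj D (UnboundedOp.mul S T) (UnboundedOp.mul T' S') := by
  intro η ξ φ ζ h1 hφ h2
  obtain ⟨χ, h1, h1'⟩ := maps_mul.1 h1
  obtain ⟨ω, h2, h2'⟩ := maps_mul.1 h2
  rw [hS _ _ _ _ h1' hφ h2, hT _ _ _ _ h1 (hD _ _ hφ h2) h2']

end UnboundedOp

namespace Site

variable {M : ℕ} [NeZero M] {A : Type*} [Ring A] [Algebra ℂ A]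

theorem nquad_hop_add (N : ℕ) (c c' : Site M → A) (U U' : ℤˣ → ℤˣ → ℂ) (q : ℤ) (t : ZMod M) :
    nquad N c c' (hop (fun α β => U α β + U' α β) q t) =
      nquad N c c' (hop U q t) + nquad N c c' (hop U' q t) := by
  unfold nquad
  simp only [← Finset.sum_add_distrib, ← add_smul]
  refine Finset.sum_congr rfl fun x _ => Finset.sum_congr rfl fun y _ => ?_
  congr 1
  unfold hop
  split_ifs
  · rfl
  · rw [add_zero]

theorem nquad_hop_smul (N : ℕ) (c c' : Site M → A) (z : ℂ) (U : ℤˣ → ℤˣ → ℂ) (q : ℤ)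
    (t : ZMod M) :
    nquad N c c' (hop (fun α β => z * U α β) q t) = z • nquad N c c' (hop U q t) := by
  unfold nquad
  simp only [Finset.smul_sum, smul_smul]
  refine Finset.sum_congr rfl fun x _ => Finset.sum_congr rfl fun y _ => ?_
  congr 1
  unfold hop
  split_ifs
  · rfl
  · rw [mul_zero]

end Site

/-! ### Action and symmetry of the densities and their ordered squares. -/

namespace Nodal

open FermionFock Site UnboundedOp

variable {L a : ℝ} {M : ℕ} {r s : ℤˣ}

theorem star_pauli (μ : Fin 4) (α β : ℤˣ) : star (pauli μ α β) = pauli μ β α := by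
  rcases Int.units_eq_one_or α with rfl | rfl <;> rcases Int.units_eq_one_or β with rfl | rfl <;>
    fin_cases μ <;> simp [pauli, sgn, units_ne_neg_self]

namespace Chart

variable (C : Chart L a r s M)

/-- The summands of the nodal bilinears in integer coordinates. -/
noncomputable def bilinTerm (U : ℤˣ → ℤˣ → ℂ) (q t : ℤ) (i : (Site M × Site M) × ℤ) :
    Fock L a →L[ℂ] Fock L a :=
  if i.1.2.2.1 = i.1.1.2.1 + q ∧ C.rep i.1.1.2.2 + t = C.rep i.1.2.2.2 + i.2 * M then
    U i.1.1.1 i.1.2.1 • bilin C.ladder C.ladderDag i.1.1 i.1.2 else 0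

/-- Reindexing of the pairs of modes of flavor `(r, s)` by integer coordinates. -/
def pairEquiv : (Site M × Site M) × ℤ ≃
    (ℤˣ × ℤˣ) × (fermiMomenta L a s × fermiMomenta L a s) × ℤ where
  toFun i := ((i.1.1.1, i.1.2.1), (C.e i.1.1.2, C.e i.1.2.2), i.2)
  invFun i := (((i.1.1, C.e.symm i.2.1.1), (i.1.2, C.e.symm i.2.1.2)), i.2.2)
  left_inv i := by simp
  right_inv i := by simp

theorem maps_J_iff (hL : 0 < L) (ha : 0 < a) (hM : L = M * a) (μ : Fin 4) (q t : ℤ)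
    {η ξ : Fock L a} :
    Maps (J L a r s μ (latticePoint L r s 0 q t)) η ξ ↔
      HasSum (fun i => C.bilinTerm (pauli μ) q t i η) ξ := by
  unfold J
  rw [maps_sum]
  simp only [maps_ofBounded]
  have hterm : ∀ i, (C.bilinTerm (pauli μ) q t i η) = (open Classical in
      if (C.pairEquiv i).2.1.1.1 + latticePoint L r s 0 q t = (C.pairEquiv i).2.1.2.1 +
          Pi.single (-s) (2 * Real.pi * (C.pairEquiv i).2.2 / a) then
        (((2 * Real.pi / L) ^ 2 : ℝ) : ℂ) •
          fermionOrder (psiDag r s (C.pairEquiv i).1.1 (C.pairEquiv i).2.1.1 *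
            (pauli μ (C.pairEquiv i).1.1 (C.pairEquiv i).1.2 •
              psi r s (C.pairEquiv i).1.2 (C.pairEquiv i).2.1.2))
      else 0) η := by
    rintro ⟨⟨x, y⟩, n⟩
    unfold bilinTerm
    simp only [pairEquiv, Equiv.coe_fn_mk, C.val, latticePoint_add_eq_iff hL ha hM,
      C.normalOrdered_eq hL]
  constructor
  · rintro ⟨f, hf, hs⟩
    rw [← C.pairEquiv.hasSum_iff] at hs
    convert hs using 1
    funext i
    rw [hterm, hf]
    rfl
  · intro h
    refine ⟨_, fun i => rfl, ?_⟩
    rw [← C.pairEquiv.hasSum_iff]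
    convert h using 1
    funext i
    rw [hterm]
    rfl

theorem star_bilinTerm (μ : Fin 4) (q t : ℤ) (x y : Site M) (n : ℤ) :
    star (C.bilinTerm (pauli μ) q t ((x, y), n)) =
      C.bilinTerm (pauli μ) (-q) (-t) ((y, x), -n) := by
  unfold bilinTerm
  have hiff : (y.2.1 = x.2.1 + q ∧ C.rep x.2.2 + t = C.rep y.2.2 + n * M) ↔
      (x.2.1 = y.2.1 + -q ∧ C.rep y.2.2 + -t = C.rep x.2.2 + -n * M) := by
    constructor
    · rintro ⟨h1, h2⟩
      exact ⟨by omega, by linear_combination -h2⟩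
    · rintro ⟨h1, h2⟩
      exact ⟨by omega, by linear_combination -h2⟩
  by_cases h : y.2.1 = x.2.1 + q ∧ C.rep x.2.2 + t = C.rep y.2.2 + n * M
  · rw [if_pos h, if_pos (hiff.1 h), star_smul, C.star_bilin, star_pauli]
  · rw [if_neg h, if_neg fun h' => h (hiff.2 h'), star_zero]

/-- Take adjoints term by term and reindex $(x,y,n)\mapsto(y,x,-n)$; unconditional convergence makes
this valid for every vector of the natural domain. -/
theorem adj_J (C : Chart L a r s M) (hL : 0 < L) (ha : 0 < a) (hM : L = M * a) (μ : Fin 4) (q t : ℤ) :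
    Adj (finiteVectors (Mode L a)) (J L a r s μ (latticePoint L r s 0 q t))
      (J L a r s μ (latticePoint L r s 0 (-q) (-t))) := by
  intro η ξ φ ζ h1 _ h2
  rw [C.maps_J_iff hL ha hM] at h1 h2
  let σ : (Site M × Site M) × ℤ ≃ (Site M × Site M) × ℤ :=
    (Equiv.prodComm _ _).prodCongr (Equiv.neg ℤ)
  refine (hasSum_inner_left h1 φ).unique ?_
  have h3 := hasSum_inner_right (σ.hasSum_iff.2 h2) η
  convert h3 using 1
  funext i
  obtain ⟨⟨x, y⟩, n⟩ := i
  change _ = ⟪η, C.bilinTerm (pauli μ) (-q) (-t) ((y, x), -n) φ⟫_ℂ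
  rw [← C.star_bilinTerm, ContinuousLinearMap.star_eq_adjoint,
    ContinuousLinearMap.adjoint_inner_right]

variable [NeZero M]

/-- `A` is the family of nodal bilinears with spin matrix `U`. -/
structure IsDensity (A : Momentum → (Fock L a →ₗ.[ℂ] Fock L a)) (U : ℤˣ → ℤˣ → ℂ) : Prop where
  maps : ∀ {N N' : ℕ} {q t : ℤ} {η : Fock L a}, IsConfined C.ladder C.ladderDag N η →
    N + |q| ≤ (N' : ℤ) →
    Maps (A (latticePoint L r s 0 q t)) η (nquad N' C.ladder C.ladderDag (hop U q t) η)
  adj : ∀ q t : ℤ, Adj (finiteVectors (Mode L a)) (A (latticePoint L r s 0 q t))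
    (A (latticePoint L r s 0 (-q) (-t)))

theorem isDensity_J (hL : 0 < L) (ha : 0 < a) (hM : L = M * a) (μ : Fin 4) :
    C.IsDensity (J L a r s μ) (pauli μ) where
  maps {N N' q t η} h hN := by
    rw [C.maps_J_iff hL ha hM]
    convert h.hasSum_hop C.isCAR (pauli μ) C.cast_rep q t hN using 1
    funext i
    unfold bilinTerm
    split_ifs <;> rfl
  adj := C.adj_J hL ha hM μ

variable {C} {A B : Momentum → (Fock L a →ₗ.[ℂ] Fock L a)} {U V : ℤˣ → ℤˣ → ℂ}

theorem IsDensity.add (hA : C.IsDensity A U) (hB : C.IsDensity B V) :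
    C.IsDensity (fun p => A p + B p) (fun α β => U α β + V α β) where
  maps h hN := by
    rw [nquad_hop_add]
    exact (hA.maps h hN).add (hB.maps h hN)
  adj q t := (hA.adj q t).add (hB.adj q t)

theorem IsDensity.smul {z : ℂ} (hz : starRingEnd ℂ z = z) (hA : C.IsDensity A U) :
    C.IsDensity (fun p => z • A p) (fun α β => z * U α β) where
  maps h hN := by
    rw [nquad_hop_smul]
    exact (hA.maps h hN).smul z
  adj q t := (hA.adj q t).smul hz

/-- Provides the invariance of the test space required by `Adj.mul`. -/
theorem IsDensity.mem_finiteVectors (hA : C.IsDensity A U) {q t : ℤ} {η ξ : Fock L a}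
    (hη : η ∈ finiteVectors (Mode L a)) (h : Maps (A (latticePoint L r s 0 q t)) η ξ) :
    ξ ∈ finiteVectors (Mode L a) := by
  obtain ⟨N, hN⟩ := C.exists_isConfined hη
  have h1 := hA.maps (N' := N + q.natAbs) (t := t) hN
    (by rw [Int.abs_eq_natAbs]; push_cast; exact le_rfl)
  rw [h.unique h1]
  exact C.nquad_mem_finiteVectors _ _ hη

theorem IsDensity.adj_orderedSquare (hA : C.IsDensity A U) (q t : ℤ) :
    Adj (finiteVectors (Mode L a)) (orderedSquare r s A (latticePoint L r s 0 q t))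
      (orderedSquare r s A (latticePoint L r s 0 q t)) := by
  have h2 := hA.adj (-q) (-t)
  rw [neg_neg, neg_neg] at h2
  unfold orderedSquare bosonOrder
  rw [neg_latticePoint]
  split_ifs
  · exact h2.mul (hA.adj q t) fun φ ζ hφ h => hA.mem_finiteVectors hφ h
  · exact (hA.adj q t).mul h2 fun φ ζ hφ h => hA.mem_finiteVectors hφ h

/-- If `q < 2 * N`, the two factors widen the window to at most `N + 2 * q < 5 * N`; otherwise the
right factor annihilates `η`. So one window serves for all transfers. -/
theorem IsDensity.maps_mul (hA : C.IsDensity A U) {N N' : ℕ} {q t : ℤ} (hq : 0 ≤ q)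
    {η : Fock L a} (h : IsConfined C.ladder C.ladderDag N η) (hN : 5 * N ≤ N') :
    Maps (UnboundedOp.mul (A (latticePoint L r s 0 (-q) (-t))) (A (latticePoint L r s 0 q t))) η
      (nquad N' C.ladder C.ladderDag (hop U (-q) (-(t : ZMod M)))
        (nquad N' C.ladder C.ladderDag (hop U q t) η)) := by
  have ht : (-(t : ZMod M)) = ((-t : ℤ) : ZMod M) := by push_cast; rfl
  have hqa : |q| = q := abs_of_nonneg hq
  have h1 := hA.maps (N' := N + q.natAbs) (t := t) h
    (by rw [Int.abs_eq_natAbs]; push_cast; exact le_rfl)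
  refine UnboundedOp.maps_mul.2 ⟨_, h1, ?_⟩
  rw [ht]
  by_cases hlt : q < 2 * N
  · have h2 := hA.maps (N' := N') (q := q) (t := t) h (by omega)
    rw [h2.unique h1]
    refine hA.maps ((h.mono (Nat.le_add_right _ _)).nquad C.isCAR _) ?_
    rw [abs_neg, hqa]
    omega
  · rw [h.nquad_hop_eq_zero C.isCAR U (by omega), h.nquad_hop_eq_zero C.isCAR U (by omega), map_zero]
    exact maps_zero_vec _

/-- Either branch of the ordering puts the density with longitudinal momentum `|q|` on the right.
For `q ≤ 0` this is the one at $-\mathbf p$, hence the reversed transverse coordinate. -/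
theorem IsDensity.maps_orderedSquare (hL : 0 < L) (hA : C.IsDensity A U) {N N' : ℕ} (q t : ℤ)
    {η : Fock L a} (h : IsConfined C.ladder C.ladderDag N η) (hN : 5 * N ≤ N') :
    Maps (orderedSquare r s A (latticePoint L r s 0 q t)) η
      ((nquad N' C.ladder C.ladderDag (hop U (-|q|) (-(if 0 < q then (t : ZMod M) else -t))) *
        nquad N' C.ladder C.ladderDag (hop U |q| (if 0 < q then (t : ZMod M) else -t))) η) := by
  unfold orderedSquare bosonOrder
  simp only [neg_latticePoint, sgn_mul_latticePoint_neg_iff hL]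
  by_cases hq : 0 < q
  · rw [if_pos (by omega), if_pos hq, abs_of_pos hq]
    exact hA.maps_mul hq.le h hN
  · rw [if_neg (by omega), if_neg hq, abs_of_nonpos (by omega)]
    have h1 := hA.maps_mul (q := -q) (t := -t) (by omega) h hN
    push_cast at h1
    simp only [neg_neg] at h1 ⊢
    exact h1

end Chart

end Nodal

/-! ### The kinetic energy and the Kronig identity on confined vectors. -/

namespace Nodal

open FermionFock Site UnboundedOp

variable {L a : ℝ} {M : ℕ} {r s : ℤˣ}

theorem exists_bosonChart [NeZero M] (hL : 0 < L) (ha : 0 < a) (hM : L = M * a) (r s : ℤˣ) :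
    ∃ (e : ℤ × ZMod M ≃ bosonMomenta L a s) (rep : ZMod M → ℤ),
      (∀ z, (rep z : ZMod M) = z) ∧ ∀ i, (e i).1 = latticePoint L r s 0 i.1 (rep i.2) := by
  obtain ⟨e, rep, h1, h2⟩ := exists_chart hL ha hM r s (o := 0) ⟨0, by simp⟩
  exact ⟨e.trans (Equiv.setCongr (bosonMomenta_eq L a s).symm), rep, h1, h2⟩

namespace Chart

variable (C : Chart L a r s M)

/-- The spin and momentum of a site. -/
def modeEquiv : Site M ≃ ℤˣ × fermiMomenta L a s := (Equiv.refl ℤˣ).prodCongr C.e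

/-- The summands of the kinetic energy are multiples of the normal ordered mode occupations. -/
theorem kinetic_term (hL : 0 < L) (x : Site M) :
    (((2 * Real.pi / L) ^ 2 * (sgn r * (C.e x.2).1 s) : ℝ) : ℂ) •
        fermionOrder (psiDag r s x.1 (C.e x.2) * psi r s x.1 (C.e x.2)) =
      ((2 * Real.pi / L : ℝ) : ℂ) • (((x.2.1 : ℂ) + 1 / 2) • bilin C.ladder C.ladderDag x x) := by
  have h := C.normalOrdered_eq hL x x 1
  rw [one_smul, one_smul] at h
  rw [mul_comm, Complex.ofReal_mul, mul_smul, h, C.energy, smul_smul]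
  push_cast
  rfl

/-- The energy of the occupied modes of flavor `(r, s)`. -/
noncomputable def modeEnergy (i : ℤˣ × fermiMomenta L a s) (S : Finset (Mode L a)) : ℝ :=
  if (⟨r, s, i.1, i.2⟩ : Mode L a) ∈ S then |sgn r * i.2.1 s| else 0

theorem exists_isMultiplication (C : Chart L a r s M) (hL : 0 < L) :
    ∃ E, IsMultiplication (kineticEnergy L a r s) E := by
  have hinj : Function.Injective fun i : ℤˣ × fermiMomenta L a s =>
      (⟨r, s, i.1, i.2⟩ : Mode L a) := by
    rintro ⟨α, k⟩ ⟨β, k'⟩ h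
    simp only [Mode.mk.injEq, true_and, heq_eq_eq] at h
    exact Prod.ext h.1 h.2
  have hfin : ∀ S : Finset (Mode L a),
      {i : ℤˣ × fermiMomenta L a s | (⟨r, s, i.1, i.2⟩ : Mode L a) ∈ S}.Finite :=
    fun S => Set.Finite.preimage hinj.injOn S.finite_toSet
  refine ⟨fun S => ∑ i ∈ (hfin S).toFinset, modeEnergy (r := r) i S, isMultiplication_sum _
    (modeEnergy (r := r)) (fun i S => ?_) _ (fun S => (hfin S).toFinset) (fun S i hi => ?_)
    (fun S => rfl) fun i η S => ?_⟩
  · unfold modeEnergy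
    split_ifs
    · exact abs_nonneg _
    · exact le_rfl
  · rw [Set.Finite.mem_toFinset] at hi
    exact if_neg hi
  · obtain ⟨x, rfl⟩ := C.modeEquiv.surjective i
    have hp : 0 ≤ 2 * Real.pi / L := by positivity
    refine (congrArg (fun B : Fock L a →L[ℂ] Fock L a => (B η) S) (C.kinetic_term hL x)).trans ?_
    simp only
    rw [smul_apply, smul_apply, lp.coeFn_smul, Pi.smul_apply, lp.coeFn_smul, Pi.smul_apply,
      C.bilin_self_apply]
    change _ = ((if C.mode x ∈ S then |sgn r * (C.e x.2).1 s| else 0 : ℝ) : ℂ) * η S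
    rw [C.energy, abs_mul, abs_of_nonneg hp]
    by_cases hS : C.mode x ∈ S
    · rw [if_pos hS, if_pos hS]
      by_cases hx : 0 ≤ x.2.1
      · have h2 : (0 : ℝ) ≤ x.2.1 := by exact_mod_cast hx
        rw [if_pos hx, abs_of_nonneg (by linarith)]
        simp only [smul_eq_mul]
        push_cast
        ring
      · have h2 : (x.2.1 : ℝ) ≤ -1 := by
          have : x.2.1 ≤ -1 := by omega
          exact_mod_cast this
        rw [if_neg hx, abs_of_nonpos (by linarith)]
        simp only [smul_eq_mul]
        push_cast
        ring
    · rw [if_neg hS, if_neg hS]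
      simp

variable [NeZero M]

/-- The action of the kinetic energy on a state which is confined to a window. -/
theorem maps_kineticEnergy (hL : 0 < L) {N N' : ℕ} {η : Fock L a}
    (h : IsConfined C.ladder C.ladderDag N η) (hN : N ≤ N') :
    Maps (kineticEnergy L a r s) η (((2 * Real.pi / L : ℝ) : ℂ) • ∑ x ∈ window M N',
      ((x.2.1 : ℂ) + 1 / 2) • bilin C.ladder C.ladderDag x x η) := by
  refine maps_sum.2 ⟨_, fun i => maps_ofBounded.2 rfl, ?_⟩
  rw [← C.modeEquiv.hasSum_iff]
  have h1 := (h.sum_bilin_self C.isCAR hN fun x => (x.2.1 : ℂ) + 1 / 2).const_smul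
    ((2 * Real.pi / L : ℝ) : ℂ)
  convert h1 using 1
  funext x
  exact DFunLike.congr_fun (C.kinetic_term hL x) η

variable {κ : Type*} [Fintype κ] {A : κ → Momentum → (Fock L a →ₗ.[ℂ] Fock L a)}
  {U : κ → ℤˣ → ℤˣ → ℂ} {w : κ → ℂ}

/-- The Kronig identity for weighted sums of normal ordered squares of densities. -/
theorem exists_sum_orderedSquare (hL : 0 < L) (ha : 0 < a) (hM : L = M * a)
    (hA : ∀ i, C.IsDensity (A i) (U i)) (hU : IsSpinResolution w U) {N : ℕ} {η : Fock L a}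
    (h : IsConfined C.ladder C.ladderDag N η) :
    ∃ (P : Finset (bosonMomenta L a s)) (G : κ → bosonMomenta L a s → Fock L a),
      (∀ i p, Maps (orderedSquare r s (A i) p.1) η (G i p)) ∧ (∀ i, ∀ p ∉ P, G i p = 0) ∧
      ((a * Real.pi : ℝ) : ℂ) • ((1 / L ^ 2 : ℝ) : ℂ) • ∑ i, w i • ∑ p ∈ P, G i p =
        ((2 * Real.pi / L : ℝ) : ℂ) • ∑ x ∈ window M (5 * N),
          ((x.2.1 : ℂ) + 1 / 2) • bilin C.ladder C.ladderDag x x η := by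
  obtain ⟨e, rep, hrep, he⟩ := exists_bosonChart hL ha hM r s
  set K : κ → ℤ → ZMod M → Fock L a →L[ℂ] Fock L a := fun i q z =>
    nquad (5 * N) C.ladder C.ladderDag (hop (U i) (-|q|) (-z)) *
      nquad (5 * N) C.ladder C.ladderDag (hop (U i) |q| z) with hK
  set G' : κ → ℤ × ZMod M → Fock L a := fun i j =>
    K i j.1 (if 0 < j.1 then j.2 else -j.2) η with hG'
  -- Twice the half-width `5 * N` of the window covers all transfers inside it; the extra 1 keeps `q
  -- = 0` in the range when `N = 0`.
  set P' : Finset (ℤ × ZMod M) :=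
    Finset.Ioo (-(10 * N + 1 : ℕ) : ℤ) (10 * N + 1 : ℕ) ×ˢ Finset.univ with hP'
  refine ⟨P'.map e.toEmbedding, fun i p => G' i (e.symm p), fun i p => ?_, fun i p hp => ?_, ?_⟩
  · obtain ⟨j, rfl⟩ := e.surjective p
    have h1 := (hA i).maps_orderedSquare hL j.1 (rep j.2) h le_rfl
    rw [hrep] at h1
    simp only [he, Equiv.symm_apply_apply]
    exact h1
  · obtain ⟨j, rfl⟩ := e.surjective p
    simp only [Equiv.symm_apply_apply, hG', hK]
    have h1 : j ∉ P' := fun hj => hp (Finset.mem_map_of_mem _ hj)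
    rw [hP', Finset.mem_product, Finset.mem_Ioo] at h1
    have h2 : 2 * (N : ℤ) ≤ |j.1| := by
      by_contra h3
      rw [not_le, abs_lt] at h3
      exact h1 ⟨⟨by push_cast; omega, by push_cast; omega⟩, Finset.mem_univ _⟩
    change nquad (5 * N) C.ladder C.ladderDag _ (nquad (5 * N) C.ladder C.ladderDag _ η) = 0
    rw [h.nquad_hop_eq_zero C.isCAR (U i) h2, map_zero]
  · have hsum : ∀ i, ∑ p ∈ P'.map e.toEmbedding, G' i (e.symm p) =
        (∑ q ∈ Finset.Ioo (-(10 * N + 1 : ℕ) : ℤ) (10 * N + 1 : ℕ), ∑ z, K i q z) η := by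
      intro i
      rw [Finset.sum_map]
      simp only [Equiv.coe_toEmbedding, Equiv.symm_apply_apply]
      rw [hP', Finset.sum_product, sum_apply]
      refine Finset.sum_congr rfl fun q _ => ?_
      rw [sum_apply, hG']
      by_cases hq : 0 < q
      · simp only [if_pos hq]
      · simp only [if_neg hq]
        -- The transverse sum runs over the whole group, so the sign reversal for `q ≤ 0` is
        -- harmless.
        exact Equiv.sum_comp (Equiv.neg (ZMod M)) fun z => K i q z η
    simp only [hsum]
    have key := DFunLike.congr_fun (sum_nquad_hop C.isCAR hU (N := 5 * N) (Q := 10 * N + 1)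
      (by omega) (by omega)) η
    rw [sum_apply, smul_apply, sum_apply] at key
    simp only [smul_apply] at key
    rw [key, smul_smul, smul_smul]
    congr 1
    have hL0 := hL.ne'
    -- The `M` transverse values cancel the prefactor precisely because `L = M * a`.
    have : a * Real.pi * (1 / L ^ 2) * (2 * M) = 2 * Real.pi / L := by
      rw [hM] at hL0 ⊢
      field_simp
    rw [← this]
    push_cast
    rfl

end Chart

/-! ### The two spin resolutions. -/

/-- The spin matrices of the densities `J_α`. -/
noncomputable def spinProjection (γ : ℤˣ) (α β : ℤˣ) : ℂ :=
  1 / 2 * (pauli 0 α β + (sgn γ : ℂ) * pauli 3 α β)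

/-- The spin matrices of `J` and of the three spin operators. -/
noncomputable def sugawaraMatrix : Option (Fin 3) → ℤˣ → ℤˣ → ℂ
  | none => pauli 0
  | some i => fun α β => 1 / 2 * pauli i.succ α β

/-- The weights of `J` and of the three spin operators in the Sugawara form. -/
noncomputable def sugawaraWeight : Option (Fin 3) → ℂ
  | none => 1 / 2
  | some _ => 2 / 3

theorem sum_units {B : Type*} [AddCommMonoid B] (f : ℤˣ → B) : ∑ α, f α = f 1 + f (-1) := by
  have : (Finset.univ : Finset ℤˣ) = {1, -1} := by decide
  rw [this, Finset.sum_pair (by decide)]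

/-- The tensor $\sum_\gamma P_\gamma\otimes P_\gamma$ has entry 1 when all four indices agree and 0
otherwise. -/
theorem isSpinResolution_projection : IsSpinResolution (fun _ => 1) spinProjection := by
  constructor
  · intro α δ β γ
    rcases Int.units_eq_one_or α with rfl | rfl <;> rcases Int.units_eq_one_or β with rfl | rfl <;>
      rcases Int.units_eq_one_or γ with rfl | rfl <;>
      rcases Int.units_eq_one_or δ with rfl | rfl <;>
      norm_num [sum_units, spinProjection, pauli, sgn, units_ne_neg_self, neg_ne_units]
  · intro α γ
    rcases Int.units_eq_one_or α with rfl | rfl <;>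
      rcases Int.units_eq_one_or γ with rfl | rfl <;>
      norm_num [sum_units, spinProjection, pauli, sgn, units_ne_neg_self, neg_ne_units]

/-- Since $\sum_i\sigma^i\otimes\sigma^i=2\,\mathrm{swap}-1$, the weights give
$\frac13(1+\mathrm{swap})$, and exchanging the column indices interchanges $1$ and swap. The squares
add up to $\frac12+\frac23\cdot\frac34=1$. -/
theorem isSpinResolution_sugawara : IsSpinResolution sugawaraWeight sugawaraMatrix := by
  have hI := Complex.I_mul_I
  constructor
  · intro α δ β γ
    rcases Int.units_eq_one_or α with rfl | rfl <;> rcases Int.units_eq_one_or β with rfl | rfl <;>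
      rcases Int.units_eq_one_or γ with rfl | rfl <;>
      rcases Int.units_eq_one_or δ with rfl | rfl <;>
      simp [Fintype.sum_option, Fin.sum_univ_three, sugawaraWeight, sugawaraMatrix, pauli, sgn,
        units_ne_neg_self] <;>
      first
        | linear_combination (1 / 6 : ℂ) * hI
        | linear_combination (-1 / 6 : ℂ) * hI
  · intro α γ
    rcases Int.units_eq_one_or α with rfl | rfl <;>
      rcases Int.units_eq_one_or γ with rfl | rfl <;>
      simp [Fintype.sum_option, Fin.sum_univ_three, sugawaraWeight, sugawaraMatrix,
        pauli, sgn, units_ne_neg_self] <;>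
      first
        | linear_combination (1 / 6 : ℂ) * hI
        | linear_combination (-1 / 6 : ℂ) * hI

end Nodal

/-! ### Identification of the three operators. -/

namespace Nodal

open FermionFock Site UnboundedOp

variable {L a : ℝ} {M : ℕ} {r s : ℤˣ}

theorem conj_half : starRingEnd ℂ (1 / 2) = 1 / 2 := by
  rw [map_div₀, map_one, map_ofNat]

namespace Chart

variable [NeZero M] (C : Chart L a r s M)

theorem isDensity_spinDensity (hL : 0 < L) (ha : 0 < a) (hM : L = M * a) (α : ℤˣ) :
    C.IsDensity (spinDensity L a r s α) (spinProjection α) :=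
  ((C.isDensity_J hL ha hM 0).add ((C.isDensity_J hL ha hM 3).smul (Complex.conj_ofReal _))).smul
    conj_half

theorem isDensity_spinOp (hL : 0 < L) (ha : 0 < a) (hM : L = M * a) (i : Fin 3) :
    C.IsDensity (spinOp L a r s i) (sugawaraMatrix (some i)) :=
  (C.isDensity_J hL ha hM i.succ).smul conj_half

/-- On states which are confined to a window, the Kronig form acts as the kinetic energy. -/
theorem maps_kronigForm (hL : 0 < L) (ha : 0 < a) (hM : L = M * a) {N : ℕ} {η : Fock L a}
    (h : IsConfined C.ladder C.ladderDag N η) :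
    Maps (kronigForm L a r s) η (((2 * Real.pi / L : ℝ) : ℂ) • ∑ x ∈ window M (5 * N),
      ((x.2.1 : ℂ) + 1 / 2) • bilin C.ladder C.ladderDag x x η) := by
  obtain ⟨P, G, hG, hG0, hsum⟩ := C.exists_sum_orderedSquare hL ha hM
    (C.isDensity_spinDensity hL ha hM) isSpinResolution_projection h
  rw [← hsum]
  refine Maps.smul _ (maps_sum.2 ⟨fun i => ((1 / L ^ 2 : ℝ) : ℂ) • G i.1 i.2,
    fun i => (hG i.1 i.2).smul _, HasSum.const_smul _ ?_⟩)
  have h1 := hasSum_sum_of_ne_finset_zero (L := SummationFilter.unconditional _)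
    (s := (Finset.univ : Finset ℤˣ) ×ˢ P) (f := fun i => G i.1 i.2) fun i hi =>
      hG0 i.1 i.2 fun hP => hi (Finset.mem_product.2 ⟨Finset.mem_univ _, hP⟩)
  rw [Finset.sum_product] at h1
  simpa only [one_smul] using h1

/-- On states which are confined to a window, the Sugawara form acts as the kinetic energy. -/
theorem maps_sugawaraForm (hL : 0 < L) (ha : 0 < a) (hM : L = M * a) {N : ℕ} {η : Fock L a}
    (h : IsConfined C.ladder C.ladderDag N η) :
    Maps (sugawaraForm L a r s) η (((2 * Real.pi / L : ℝ) : ℂ) • ∑ x ∈ window M (5 * N),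
      ((x.2.1 : ℂ) + 1 / 2) • bilin C.ladder C.ladderDag x x η) := by
  obtain ⟨P, G, hG, hG0, hsum⟩ := C.exists_sum_orderedSquare hL ha hM
    (A := fun i => i.elim (J L a r s 0) (spinOp L a r s)) (U := sugawaraMatrix)
    (by
      rintro (_ | i)
      · exact C.isDensity_J hL ha hM 0
      · exact C.isDensity_spinOp hL ha hM i) isSpinResolution_sugawara h
  rw [← hsum]
  refine Maps.smul _ (maps_sum.2 ⟨fun p => ((1 / L ^ 2 : ℝ) : ℂ) •
    ((1 / 2 : ℂ) • G none p + (2 / 3 : ℂ) • ∑ i, G (some i) p), fun p => Maps.smul _ ?_,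
    HasSum.const_smul _ ?_⟩)
  · refine ((hG none p).smul _).add (Maps.smul _ ?_)
    rw [Fin.sum_univ_three, Fin.sum_univ_three]
    exact ((hG (some 0) p).add (hG (some 1) p)).add (hG (some 2) p)
  · have h1 := hasSum_sum_of_ne_finset_zero (L := SummationFilter.unconditional _)
      (s := P) (f := fun p => (1 / 2 : ℂ) • G none p + (2 / 3 : ℂ) • ∑ i, G (some i) p)
      fun p hp => by simp only [hG0 _ p hp, smul_zero, Finset.sum_const_zero, add_zero]
    convert h1 using 1
    rw [Fintype.sum_option, Finset.sum_add_distrib, ← Finset.smul_sum, ← Finset.smul_sum,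
      Finset.sum_comm]
    simp only [sugawaraWeight, Finset.smul_sum]

theorem adj_orderedSquare {A : Momentum → (Fock L a →ₗ.[ℂ] Fock L a)} {U : ℤˣ → ℤˣ → ℂ}
    (hL : 0 < L) (ha : 0 < a) (hM : L = M * a) (hA : C.IsDensity A U) (p : bosonMomenta L a s) :
    Adj (finiteVectors (Mode L a)) (orderedSquare r s A p.1) (orderedSquare r s A p.1) := by
  obtain ⟨e, rep, -, he⟩ := exists_bosonChart hL ha hM r s
  obtain ⟨j, rfl⟩ := e.surjective p
  rw [he]
  exact hA.adj_orderedSquare _ _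

theorem adj_kronigForm (C : Chart L a r s M) (hL : 0 < L) (ha : 0 < a) (hM : L = M * a) :
    Adj (finiteVectors (Mode L a)) (kronigForm L a r s) (kronigForm L a r s) := by
  refine Adj.smul (Complex.conj_ofReal _) (Adj.sum fun i => Adj.smul (Complex.conj_ofReal _) ?_)
  exact C.adj_orderedSquare hL ha hM (C.isDensity_spinDensity hL ha hM i.1) i.2

theorem adj_sugawaraForm (C : Chart L a r s M) (hL : 0 < L) (ha : 0 < a) (hM : L = M * a) :
    Adj (finiteVectors (Mode L a)) (sugawaraForm L a r s) (sugawaraForm L a r s) := by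
  have hspin := fun i p => C.adj_orderedSquare hL ha hM (C.isDensity_spinOp hL ha hM i) p
  refine Adj.smul (Complex.conj_ofReal _) (Adj.sum fun p =>
    Adj.smul (Complex.conj_ofReal _) (Adj.add (Adj.smul conj_half ?_)
      (Adj.smul (by rw [map_div₀, map_ofNat, map_ofNat]) ?_)))
  · exact C.adj_orderedSquare hL ha hM (C.isDensity_J hL ha hM 0) p
  · rw [Fin.sum_univ_three]
    exact ((hspin 0 p).add (hspin 1 p)).add (hspin 2 p)

end Chart

/-- A symmetric operator which agrees with the kinetic energy on finite vectors has the kinetic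
energy as its closure. -/
theorem closure_eq_kineticEnergy {E : Finset (Mode L a) → ℝ}
    (hE : IsMultiplication (kineticEnergy L a r s) E) {T : Fock L a →ₗ.[ℂ] Fock L a}
    (hT : Adj (finiteVectors (Mode L a)) T T)
    (h : ∀ η ∈ finiteVectors (Mode L a), ∃ ξ, Maps (kineticEnergy L a r s) η ξ ∧ Maps T η ξ) :
    T.closure = kineticEnergy L a r s := by
  have h1 : ∀ S, Maps T (basisVec S) ((E S : ℂ) • basisVec S) := fun S => by
    obtain ⟨ξ, h2, h3⟩ := h _ (basisVec_mem S)
    rwa [← h2.unique (hE.maps_basisVec S)]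
  exact hE.closure_eq h1 fun η ξ S h2 => hT _ _ _ _ h2 (basisVec_mem S) (h1 S)

end Nodal

theorem propositionC4 (L a : ℝ) (hL : 0 < L) (ha : 0 < a) (hLa : ∃ M : ℕ, L = M * a)
    (r s : ℤˣ) :
    (∀ η ∈ FermionFock.finiteVectors (Nodal.Mode L a),
      ∃ (h₁ : η ∈ (Nodal.kineticEnergy L a r s).domain)
        (h₂ : η ∈ (Nodal.kronigForm L a r s).domain)
        (h₃ : η ∈ (Nodal.sugawaraForm L a r s).domain),
        Nodal.kineticEnergy L a r s ⟨η, h₁⟩ = Nodal.kronigForm L a r s ⟨η, h₂⟩ ∧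
        Nodal.kronigForm L a r s ⟨η, h₂⟩ = Nodal.sugawaraForm L a r s ⟨η, h₃⟩) ∧
    Nodal.kineticEnergy L a r s = (Nodal.kronigForm L a r s).closure ∧
    (Nodal.kronigForm L a r s).closure = (Nodal.sugawaraForm L a r s).closure ∧
    IsSelfAdjoint (Nodal.kineticEnergy L a r s) ∧
    IsSelfAdjoint (Nodal.kronigForm L a r s).closure ∧
    IsSelfAdjoint (Nodal.sugawaraForm L a r s).closure := by
  obtain ⟨M, hM⟩ := hLa
  have hM0 : NeZero M := ⟨by
    rintro rfl
    rw [Nat.cast_zero, zero_mul] at hM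
    exact hL.ne' hM⟩
  obtain ⟨C⟩ := Nodal.Chart.nonempty hL ha hM r s
  have hmaps : ∀ η ∈ FermionFock.finiteVectors (Nodal.Mode L a), ∃ ξ,
      UnboundedOp.Maps (Nodal.kineticEnergy L a r s) η ξ ∧
      UnboundedOp.Maps (Nodal.kronigForm L a r s) η ξ ∧
      UnboundedOp.Maps (Nodal.sugawaraForm L a r s) η ξ := by
    intro η hη
    obtain ⟨N, hN⟩ := C.exists_isConfined hη
    exact ⟨_, C.maps_kineticEnergy hL hN (by omega : N ≤ 5 * N), C.maps_kronigForm hL ha hM hN,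
      C.maps_sugawaraForm hL ha hM hN⟩
  obtain ⟨E, hE⟩ := C.exists_isMultiplication hL
  have h2 : (Nodal.kronigForm L a r s).closure = Nodal.kineticEnergy L a r s :=
    Nodal.closure_eq_kineticEnergy hE (C.adj_kronigForm hL ha hM) fun η hη => by
      obtain ⟨ξ, h1, h2, -⟩ := hmaps η hη
      exact ⟨ξ, h1, h2⟩
  have h3 : (Nodal.sugawaraForm L a r s).closure = Nodal.kineticEnergy L a r s :=
    Nodal.closure_eq_kineticEnergy hE (C.adj_sugawaraForm hL ha hM) fun η hη => by
      obtain ⟨ξ, h1, -, h3⟩ := hmaps η hη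
      exact ⟨ξ, h1, h3⟩
  rw [h2, h3]
  refine ⟨fun η hη => ?_, rfl, rfl, hE.isSelfAdjoint, hE.isSelfAdjoint, hE.isSelfAdjoint⟩
  obtain ⟨ξ, ⟨h4, h4'⟩, ⟨h5, h5'⟩, ⟨h6, h6'⟩⟩ := hmaps η hη
  exact ⟨h4, h5, h6, h4'.trans h5'.symm, h5'.trans h6'.symm⟩
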